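/- Let $G$ be a finite group with identity $1$, let $R$ be a commutative ring with unity, and let $\alpha=(D_g,\alpha_g)_{g\in G}$ be a unital partial action of $G$ on $R$: each $D_g=R1_g$ is an ideal generated by an idempotent $1_g$, each $\alpha_g:D_{g^{-1}}\to D_g$ is a ring isomorphism, $D_1=R$, $\alpha_1=\mathrm{id}_R$, $\alpha_h^{-1}(D_h\cap D_{g^{-1}})\subseteq D_{(gh)^{-1}}$, and $\alpha_g(\alpha_h(x))=\alpha_{gh}(x)$ for $x\in\alpha_h^{-1}(D_h\cap D_{g^{-1}})$. Let $R^\alpha=\{r\in R:\alpha_g(r1_{g^{-1}})=r1_g\text{ for all }g\in G\}$ and assume that $R^\alpha\subseteq R$ is a partial Galois extension, i.e. there are $m\in\mathbb N$ and $x_i,y_i\in R$ $(1\le i\le m)$ with $\sum_{i=1}^m x_i\,\alpha_g(y_i1_{g^{-1}})=\delta_{1,g}$ for every $g\in G$. Let $S=R\star_\alpha G=\bigoplus_{g\in G}D_g\delta_g$ be the partial skew group ring, with multiplication $(r\delta_g)(s\delta_h)=r\,\alpha_g(s1_{g^{-1}})\,\delta_{gh}$; it contains $R$ through $r\mapsto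 r\delta_1$. Let $\mathcal M(S/R)$ be the category whose objects are the $R$-bilinear maps $\phi:P\to X$ from an $R$-bimodule $P$ to an $S$-bimodule $X$ such that $P\otimes_RS\to X$, $p\otimes s\mapsto\phi(p)s$, and $S\otimes_RP\to X$, $s\otimes p\mapsto s\phi(p)$, are isomorphisms; an isomorphism from $\phi:P\to X$ to $\psi:Q\to Y$ is a pair of bimodule isomorphisms $P\to Q$ (over $R$) and $X\to Y$ (over $S$) that commute with $\phi$ and $\psi$. Let $\mathcal P(S/R)$ be the group of isomorphism classes $([P]\overset{[\phi]}{\Rightarrow}[X])$ of objects for which $P$ is an invertible $R$-bimodule and $X$ an invertible $S$-bimodule, with product the class of $\phi\otimes\psi:P\otimes_RQ\to X\otimes_SY$ and with identity the class of the inclusion $R\to S$. Let $\mathcal P_R(S/R)^{(G)}$ be its subgroup of the classes for which $rp=pr$ for all $r\in R$, $p\in P$, and $(D_g\delta_g)\phi(P)=\phi(P)(D_g\delta_g)$ for all $g\in G$. Let $\mathbf{Pic}_{R^\alpha}(R^\alpha)$ be the Picard group of the commutative ring $R^\alpha$, that is, the group of isomorphism classes of invertible $R^\alpha$-modules under $\otimes_{R^\alpha}$.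 Then $$\xi:\mathbf{Pic}_{R^\alpha}(R^\alpha)\longrightarrow\mathcal P_R(S/R)^{(G)},\qquad [P_0]\longmapsto\big([P_0\otimes_{R^\alpha}R]\overset{[\phi]}{\Longrightarrow}[P_0\otimes_{R^\alpha}S]\big),$$ where $\phi:P_0\otimes_{R^\alpha}R\to P_0\otimes_{R^\alpha}S$ is induced by the inclusion $R\subseteq S$ and the bimodule structures are $s_1(p\otimes s)s_2=p\otimes s_1ss_2$ (over $S$, and likewise over $R$), is a well-defined isomorphism of groups. -/

import Mathlib

universe u v w

namespace RelPicard

open MulOpposite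

open scoped TensorProduct

/-! ### The tensor product of bimodules over a noncommutative ring -/

section Tensor

variable (R : Type*) [Ring R]

/-- The subgroup generated by all `m r ⊗ n - m ⊗ r n`; right actions of `R` are left
actions of the opposite ring. -/
def balanced (M N : Type*) [AddCommGroup M] [AddCommGroup N] [Module Rᵐᵒᵖ M] [Module R N] :
    AddSubgroup (M ⊗[ℤ] N) :=
  AddSubgroup.closure {t | ∃ (m : M) (r : R) (n : N), t = (op r • m) ⊗ₜ n - m ⊗ₜ (r • n)}

/-- The tensor product `M ⊗_R N` of a right `R`-module and a left `R`-module. -/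
def BTensor (M N : Type*) [AddCommGroup M] [AddCommGroup N] [Module Rᵐᵒᵖ M] [Module R N] :=
  (M ⊗[ℤ] N) ⧸ balanced R M N

variable {M N : Type*} [AddCommGroup M] [AddCommGroup N] [Module Rᵐᵒᵖ M] [Module R N]

instance : AddCommGroup (BTensor R M N) :=
  inferInstanceAs (AddCommGroup ((M ⊗[ℤ] N) ⧸ balanced R M N))

namespace BTensor

/-- The quotient map. -/
def proj (M N : Type*) [AddCommGroup M] [AddCommGroup N] [Module Rᵐᵒᵖ M] [Module R N] :
    M ⊗[ℤ] N →+ BTensor R M N :=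
  QuotientAddGroup.mk' (balanced R M N)

/-- The elementary tensor `m ⊗ n`. -/
def tmul (m : M) (n : N) : BTensor R M N := proj R M N (m ⊗ₜ n)

theorem add_tmul (m m' : M) (n : N) : tmul R (m + m') n = tmul R m n + tmul R m' n := by
  simp only [tmul, TensorProduct.add_tmul, map_add]

theorem tmul_add (m : M) (n n' : N) : tmul R m (n + n') = tmul R m n + tmul R m n' := by
  simp only [tmul, TensorProduct.tmul_add, map_add]

theorem smul_tmul (r : R) (m : M) (n : N) : tmul R (op r • m) n = tmul R m (r • n) := by
  refine (QuotientAddGroup.eq_iff_sub_mem (N := balanced R M N)).2 ?_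
  exact AddSubgroup.subset_closure ⟨m, r, n, rfl⟩

variable {R} in
@[elab_as_elim]
theorem induction {p : BTensor R M N → Prop} (t : BTensor R M N)
    (hz : p 0) (ht : ∀ m n, p (tmul R m n)) (ha : ∀ a b, p a → p b → p (a + b)) : p t := by
  obtain ⟨t, rfl⟩ : ∃ t', proj R M N t' = t :=
    QuotientAddGroup.mk'_surjective (balanced R M N) t
  induction t using TensorProduct.induction_on with
  | zero => rw [map_zero]; exact hz
  | tmul m n => exact ht m n
  | add a b h1 h2 => rw [map_add]; exact ha _ _ h1 h2

/-- The additive map induced by a biadditive balanced map. -/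
def lift {A : Type*} [AddCommGroup A] (f : M →+ N →+ A)
    (hf : ∀ m (r : R) n, f (op r • m) n = f m (r • n)) : BTensor R M N →+ A :=
  QuotientAddGroup.lift (balanced R M N)
    (TensorProduct.liftAddHom (R := ℤ) f (by intro r m n; simp))
    ((AddSubgroup.closure_le _).2 (by
      rintro _ ⟨m, r, n, rfl⟩
      change _ = _
      rw [map_sub, sub_eq_zero]
      exact hf m r n))

@[simp] theorem lift_tmul {A : Type*} [AddCommGroup A] (f : M →+ N →+ A)
    (hf : ∀ m (r : R) n, f (op r • m) n = f m (r • n)) (m : M) (n : N) :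
    lift R f hf (tmul R m n) = f m n := rfl

variable {R} in
theorem hom_ext {A : Type*} [AddCommGroup A] {f g : BTensor R M N →+ A}
    (h : ∀ m n, f (tmul R m n) = g (tmul R m n)) : f = g := by
  ext t
  induction t using induction with
  | hz => simp
  | ht m n => exact h m n
  | ha a b h1 h2 => rw [map_add, map_add, h1, h2]

/-- The biadditive map `(m, n) ↦ m ⊗ n`. -/
def mkHom : M →+ N →+ BTensor R M N :=
  AddMonoidHom.mk' (fun m => AddMonoidHom.mk' (fun n => tmul R m n) (tmul_add R m))
    (fun m m' => by ext n; exact add_tmul R m m' n)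

@[simp] theorem zero_tmul (n : N) : tmul R (0 : M) n = 0 := map_zero ((mkHom R).flip n)

@[simp] theorem tmul_zero (m : M) : tmul R m (0 : N) = 0 := map_zero (mkHom R m)

@[simp] theorem mkHom_apply (m : M) (n : N) : mkHom R m n = tmul R m n := rfl

variable {M' N' : Type*} [AddCommGroup M'] [AddCommGroup N'] [Module Rᵐᵒᵖ M'] [Module R N']

/-- The map `f ⊗ g` induced by a right linear `f` and a left linear `g`. -/
def map (f : M →+ M') (g : N →+ N') (hf : ∀ (r : R) m, f (op r • m) = op r • f m)
    (hg : ∀ (r : R) n, g (r • n) = r • g n) : BTensor R M N →+ BTensor R M' N' :=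
  lift R (((mkHom R).comp f).compl₂ g) (by
    intro m r n
    simp [hf, hg, smul_tmul])

@[simp] theorem map_tmul (f : M →+ M') (g : N →+ N')
    (hf : ∀ (r : R) m, f (op r • m) = op r • f m)
    (hg : ∀ (r : R) n, g (r • n) = r • g n) (m : M) (n : N) :
    map R f g hf hg (tmul R m n) = tmul R (f m) (g n) := rfl

/-- The left action of `R` on `M ⊗_R N` when `M` is a bimodule: `r (m ⊗ n) = r m ⊗ n`. -/
instance leftModule [Module R M] [SMulCommClass R Rᵐᵒᵖ M] : Module R (BTensor R M N) where
  smul r := map R (DistribSMul.toAddMonoidHom M r) (AddMonoidHom.id N)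
    (fun s m => smul_comm r (op s) m) (fun _ _ => rfl)
  one_smul t := by
    change map R _ _ _ _ t = t
    induction t using induction with
    | hz => simp
    | ht m n => exact congrArg (tmul R · n) (one_smul R m)
    | ha a b h1 h2 => rw [map_add, h1, h2]
  mul_smul r s t := by
    change map R _ _ _ _ t = map R _ _ _ _ (map R _ _ _ _ t)
    induction t using induction with
    | hz => simp
    | ht m n => exact congrArg (tmul R · n) (mul_smul r s m)
    | ha a b h1 h2 => simp only [map_add, h1, h2]
  smul_zero r := map_zero _
  smul_add r := map_add _
  add_smul r s t := by
    change map R _ _ _ _ t = map R _ _ _ _ t + map R _ _ _ _ t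
    induction t using induction with
    | hz => simp
    | ht m n => exact (congrArg (tmul R · n) (add_smul r s m)).trans (add_tmul R _ _ _)
    | ha a b h1 h2 => simp only [map_add, h1, h2]; abel
  zero_smul t := by
    change map R _ _ _ _ t = 0
    induction t using induction with
    | hz => simp
    | ht m n =>
      exact (congrArg (tmul R · n) (zero_smul R m)).trans (map_zero ((mkHom R).flip n))
    | ha a b h1 h2 => simp only [map_add, h1, h2]; abel

/-- The right action of `R` on `M ⊗_R N` when `N` is a bimodule: `(m ⊗ n) r = m ⊗ n r`. -/
instance rightModule [Module Rᵐᵒᵖ N] [SMulCommClass R Rᵐᵒᵖ N] :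
    Module Rᵐᵒᵖ (BTensor R M N) where
  smul r := map R (AddMonoidHom.id M) (DistribSMul.toAddMonoidHom N r)
    (fun _ _ => rfl) (fun s n => (smul_comm s r n).symm)
  one_smul t := by
    change map R _ _ _ _ t = t
    induction t using induction with
    | hz => simp
    | ht m n => exact congrArg (tmul R m ·) (one_smul Rᵐᵒᵖ n)
    | ha a b h1 h2 => rw [map_add, h1, h2]
  mul_smul r s t := by
    change map R _ _ _ _ t = map R _ _ _ _ (map R _ _ _ _ t)
    induction t using induction with
    | hz => simp
    | ht m n => exact congrArg (tmul R m ·) (mul_smul r s n)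
    | ha a b h1 h2 => simp only [map_add, h1, h2]
  smul_zero r := map_zero _
  smul_add r := map_add _
  add_smul r s t := by
    change map R _ _ _ _ t = map R _ _ _ _ t + map R _ _ _ _ t
    induction t using induction with
    | hz => simp
    | ht m n => exact (congrArg (tmul R m ·) (add_smul r s n)).trans (tmul_add R _ _ _)
    | ha a b h1 h2 => simp only [map_add, h1, h2]; abel
  zero_smul t := by
    change map R _ _ _ _ t = 0
    induction t using induction with
    | hz => simp
    | ht m n =>
      exact (congrArg (tmul R m ·) (zero_smul Rᵐᵒᵖ n)).trans (map_zero (mkHom R m))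
    | ha a b h1 h2 => simp only [map_add, h1, h2]; abel

theorem smul_tmul_left [Module R M] [SMulCommClass R Rᵐᵒᵖ M] (r : R) (m : M) (n : N) :
    r • tmul R m n = tmul R (r • m) n := rfl

theorem smul_tmul_right [Module Rᵐᵒᵖ N] [SMulCommClass R Rᵐᵒᵖ N] (r : R) (m : M) (n : N) :
    op r • tmul R m n = tmul R m (op r • n) := rfl

instance [Module R M] [SMulCommClass R Rᵐᵒᵖ M] [Module Rᵐᵒᵖ N] [SMulCommClass R Rᵐᵒᵖ N] :
    SMulCommClass R Rᵐᵒᵖ (BTensor R M N) where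
  smul_comm r s t := by
    induction t using induction with
    | hz => simp
    | ht m n => rfl
    | ha a b h1 h2 => simp only [smul_add, h1, h2]

end BTensor

end Tensor

/-! ### Isomorphisms of bimodules and invertible bimodules -/

/-- Isomorphisms of `R`-bimodules. -/
structure BimodEquiv (R : Type*) [Ring R] (P Q : Type*) [AddCommGroup P] [Module R P]
    [Module Rᵐᵒᵖ P] [AddCommGroup Q] [Module R Q] [Module Rᵐᵒᵖ Q] extends P ≃+ Q where
  map_left : ∀ (r : R) p, toFun (r • p) = r • toFun p
  map_right : ∀ (r : R) p, toFun (op r • p) = op r • toFun p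

namespace BimodEquiv

variable {R : Type*} [Ring R] {P Q T : Type*}
  [AddCommGroup P] [Module R P] [Module Rᵐᵒᵖ P]
  [AddCommGroup Q] [Module R Q] [Module Rᵐᵒᵖ Q]
  [AddCommGroup T] [Module R T] [Module Rᵐᵒᵖ T]

theorem left (e : BimodEquiv R P Q) (r : R) (p : P) :
    e.toAddEquiv (r • p) = r • e.toAddEquiv p := e.map_left r p

theorem right (e : BimodEquiv R P Q) (r : R) (p : P) :
    e.toAddEquiv (op r • p) = op r • e.toAddEquiv p := e.map_right r p

/-- The identity. -/
def refl : BimodEquiv R P P where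
  __ := AddEquiv.refl P
  map_left _ _ := rfl
  map_right _ _ := rfl

/-- The inverse isomorphism. -/
def symm (e : BimodEquiv R P Q) : BimodEquiv R Q P where
  __ := e.toAddEquiv.symm
  map_left r q := by
    change e.toAddEquiv.symm (r • q) = r • e.toAddEquiv.symm q
    rw [AddEquiv.symm_apply_eq, left, AddEquiv.apply_symm_apply]
  map_right r q := by
    change e.toAddEquiv.symm (op r • q) = op r • e.toAddEquiv.symm q
    rw [AddEquiv.symm_apply_eq, right, AddEquiv.apply_symm_apply]

/-- The composition of isomorphisms. -/
def trans (e : BimodEquiv R P Q) (f : BimodEquiv R Q T) : BimodEquiv R P T where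
  __ := e.toAddEquiv.trans f.toAddEquiv
  map_left r p := by
    change f.toAddEquiv (e.toAddEquiv (r • p)) = r • f.toAddEquiv (e.toAddEquiv p)
    rw [left, left]
  map_right r p := by
    change f.toAddEquiv (e.toAddEquiv (op r • p)) = op r • f.toAddEquiv (e.toAddEquiv p)
    rw [right, right]

/-- An isomorphism from a bijective bilinear map. -/
noncomputable def ofBijective (f : P →+ Q) (hl : ∀ (r : R) p, f (r • p) = r • f p)
    (hr : ∀ (r : R) p, f (op r • p) = op r • f p) (hf : Function.Bijective f) :
    BimodEquiv R P Q where
  __ := AddEquiv.ofBijective f hf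
  map_left := hl
  map_right := hr

end BimodEquiv

namespace BTensor

variable (R : Type*) [Ring R]

section congr

variable {M N M' N' : Type*} [AddCommGroup M] [AddCommGroup N] [AddCommGroup M']
  [AddCommGroup N'] [Module Rᵐᵒᵖ M] [Module R N] [Module Rᵐᵒᵖ M'] [Module R N']

/-- `e ⊗ f` is bijective when `e` and `f` are. -/
def congrAdd (e : M ≃+ M') (f : N ≃+ N') (he : ∀ (r : R) m, e (op r • m) = op r • e m)
    (hf : ∀ (r : R) n, f (r • n) = r • f n) : BTensor R M N ≃+ BTensor R M' N' :=
  AddMonoidHom.toAddEquiv (map R e.toAddMonoidHom f.toAddMonoidHom he hf)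
    (map R e.symm.toAddMonoidHom f.symm.toAddMonoidHom
      (fun r m => by
        change e.symm (op r • m) = op r • e.symm m
        rw [AddEquiv.symm_apply_eq, he, AddEquiv.apply_symm_apply])
      (fun r m => by
        change f.symm (r • m) = r • f.symm m
        rw [AddEquiv.symm_apply_eq, hf, AddEquiv.apply_symm_apply]))
    (hom_ext fun m n => by simp) (hom_ext fun m n => by simp)

@[simp] theorem congrAdd_tmul (e : M ≃+ M') (f : N ≃+ N')
    (he : ∀ (r : R) m, e (op r • m) = op r • e m)
    (hf : ∀ (r : R) n, f (r • n) = r • f n) (m : M) (n : N) :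
    congrAdd R e f he hf (tmul R m n) = tmul R (e m) (f n) := rfl

variable [Module R M] [SMulCommClass R Rᵐᵒᵖ M] [Module R M'] [SMulCommClass R Rᵐᵒᵖ M']
  [Module Rᵐᵒᵖ N] [SMulCommClass R Rᵐᵒᵖ N] [Module Rᵐᵒᵖ N'] [SMulCommClass R Rᵐᵒᵖ N']

/-- The tensor product of two isomorphisms of bimodules. -/
def congr (e : BimodEquiv R M M') (f : BimodEquiv R N N') :
    BimodEquiv R (BTensor R M N) (BTensor R M' N') where
  __ := congrAdd R e.toAddEquiv f.toAddEquiv e.right f.left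
  map_left r t := by
    change congrAdd R _ _ _ _ _ = r • congrAdd R _ _ _ _ _
    induction t using induction with
    | hz => simp
    | ht m n => simp [smul_tmul_left, e.left]
    | ha a b h1 h2 => simp only [map_add, smul_add, h1, h2]
  map_right r t := by
    change congrAdd R _ _ _ _ _ = op r • congrAdd R _ _ _ _ _
    induction t using induction with
    | hz => simp
    | ht m n => simp [smul_tmul_right, f.right]
    | ha a b h1 h2 => simp only [map_add, smul_add, h1, h2]

@[simp] theorem congr_tmul (e : BimodEquiv R M M') (f : BimodEquiv R N N') (m : M) (n : N) :
    (congr R e f).toAddEquiv (tmul R m n) = tmul R (e.toAddEquiv m) (f.toAddEquiv n) := rfl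

end congr

section assoc

variable (M N K : Type*) [AddCommGroup M] [AddCommGroup N] [AddCommGroup K]
  [Module Rᵐᵒᵖ M] [Module R N] [Module Rᵐᵒᵖ N] [SMulCommClass R Rᵐᵒᵖ N] [Module R K]

/-- The map `(m ⊗ n) ⊗ k ↦ m ⊗ (n ⊗ k)`. -/
def assocHom : BTensor R (BTensor R M N) K →+ BTensor R M (BTensor R N K) :=
  lift R (lift R
    (AddMonoidHom.mk' (fun m => AddMonoidHom.mk'
        (fun n => ((mkHom R m).comp (mkHom R n) : K →+ BTensor R M (BTensor R N K)))
        (fun a b => by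
          ext k
          exact (congrArg (tmul R m) (add_tmul R a b k)).trans (tmul_add R _ _ _)))
      (fun a b => by ext n k; exact add_tmul R a b _))
    (fun m r n => by ext k; exact smul_tmul R r m _))
    (fun t r k => by
      induction t using induction with
      | hz => rw [smul_zero, map_zero]; rfl
      | ht m n => exact congrArg (tmul R m) (smul_tmul R r n k)
      | ha a b h1 h2 => rw [smul_add, map_add, map_add, AddMonoidHom.add_apply,
          AddMonoidHom.add_apply, h1, h2])

/-- The map `m ⊗ (n ⊗ k) ↦ (m ⊗ n) ⊗ k`. -/
def assocInv : BTensor R M (BTensor R N K) →+ BTensor R (BTensor R M N) K :=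
  lift R
    (AddMonoidHom.mk' (fun m => lift R
        (AddMonoidHom.mk' (fun n => (mkHom R (tmul R m n) : K →+ BTensor R (BTensor R M N) K))
          (fun a b => by
            ext k
            exact (congrArg (tmul R · k) (tmul_add R m a b)).trans (add_tmul R _ _ _)))
        (fun n r k => smul_tmul R r (tmul R m n) k))
      (fun a b => hom_ext fun n k =>
        (congrArg (tmul R · k) (add_tmul R a b n)).trans (add_tmul R _ _ _)))
    (fun m r t => by
      induction t using induction with
      | hz => rw [smul_zero, map_zero, map_zero]
      | ht n k => exact congrArg (tmul R · k) (smul_tmul R r m n)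
      | ha a b h1 h2 => rw [smul_add, map_add, map_add, h1, h2])

/-- `(M ⊗ N) ⊗ K ≃ M ⊗ (N ⊗ K)` as additive groups. -/
def assocAdd : BTensor R (BTensor R M N) K ≃+ BTensor R M (BTensor R N K) :=
  AddMonoidHom.toAddEquiv (assocHom R M N K) (assocInv R M N K)
    (by
      refine hom_ext fun t k => ?_
      induction t using induction with
      | hz => rw [zero_tmul, map_zero, map_zero]
      | ht m n => rfl
      | ha a b h1 h2 => rw [add_tmul, map_add, map_add, h1, h2])
    (by
      refine hom_ext fun m t => ?_
      induction t using induction with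
      | hz => rw [tmul_zero, map_zero, map_zero]
      | ht m n => rfl
      | ha a b h1 h2 => rw [tmul_add, map_add, map_add, h1, h2])

variable {M N K} in
@[simp] theorem assocAdd_tmul (m : M) (n : N) (k : K) :
    assocAdd R M N K (tmul R (tmul R m n) k) = tmul R m (tmul R n k) := rfl

variable {R M N K} in
theorem hom_ext₂ {A : Type*} [AddCommGroup A] {f g : BTensor R (BTensor R M N) K →+ A}
    (h : ∀ m n k, f (tmul R (tmul R m n) k) = g (tmul R (tmul R m n) k)) : f = g := by
  have : f.comp (assocInv R M N K) = g.comp (assocInv R M N K) := by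
    refine hom_ext fun m t => ?_
    induction t using induction with
    | hz => rw [tmul_zero, map_zero, map_zero]
    | ht n k => exact h m n k
    | ha a b h1 h2 => rw [tmul_add, map_add, map_add, h1, h2]
  ext t
  have h2 := DFunLike.congr_fun this (assocAdd R M N K t)
  have h3 : assocInv R M N K (assocAdd R M N K t) = t := (assocAdd R M N K).symm_apply_apply t
  simpa [h3] using h2

/-- The associativity isomorphism of bimodules. -/
def assoc [Module R M] [SMulCommClass R Rᵐᵒᵖ M] [Module Rᵐᵒᵖ K] [SMulCommClass R Rᵐᵒᵖ K] :
    BimodEquiv R (BTensor R (BTensor R M N) K) (BTensor R M (BTensor R N K)) where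
  __ := assocAdd R M N K
  map_left r t := by
    change assocAdd R M N K _ = r • assocAdd R M N K _
    induction t using induction with
    | hz => simp
    | ht t k =>
      induction t using induction with
      | hz => simp
      | ht m n => rfl
      | ha a b h1 h2 => simp only [add_tmul, map_add, smul_add, h1, h2]
    | ha a b h1 h2 => simp only [map_add, smul_add, h1, h2]
  map_right r t := by
    change assocAdd R M N K _ = op r • assocAdd R M N K _
    induction t using induction with
    | hz => simp
    | ht t k =>
      induction t using induction with
      | hz => simp
      | ht m n => rfl
      | ha a b h1 h2 => simp only [add_tmul, map_add, smul_add, h1, h2]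
    | ha a b h1 h2 => simp only [map_add, smul_add, h1, h2]

end assoc

section unit

variable (M : Type*) [AddCommGroup M] [Module R M] [Module Rᵐᵒᵖ M] [SMulCommClass R Rᵐᵒᵖ M]

/-- `R ⊗_R M ≃ M`. -/
def lid : BimodEquiv R (BTensor R R M) M where
  __ := AddMonoidHom.toAddEquiv
    (lift R (AddMonoidHom.mk' (fun r => DistribSMul.toAddMonoidHom M r)
        (fun a b => by ext m; exact add_smul a b m))
      (fun a r m => mul_smul a r m))
    (mkHom R 1)
    (hom_ext fun a m => by
      change tmul R 1 (a • m) = tmul R a m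
      rw [← smul_tmul]
      exact congrArg (tmul R · m) (one_mul a))
    (by ext m; exact one_smul R m)
  map_left r t := by
    change lift R _ _ (r • t) = r • lift R _ _ t
    induction t using induction with
    | hz => simp
    | ht a m => exact mul_smul r a m
    | ha a b h1 h2 => simp only [map_add, smul_add, h1, h2]
  map_right r t := by
    change lift R _ _ (op r • t) = op r • lift R _ _ t
    induction t using induction with
    | hz => simp
    | ht a m => exact smul_comm a (op r) m
    | ha a b h1 h2 => simp only [map_add, smul_add, h1, h2]

/-- `M ⊗_R R ≃ M`. -/
def rid : BimodEquiv R (BTensor R M R) M where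
  __ := AddMonoidHom.toAddEquiv
    (lift R (AddMonoidHom.mk' (fun m => AddMonoidHom.mk' (fun r : R => op r • m)
          (fun a b => by rw [op_add, add_smul]))
        (fun a b => by ext r; exact smul_add _ a b))
      (fun m r a => by
        change op a • op r • m = op (r * a) • m
        rw [op_mul, mul_smul]))
    ((mkHom R).flip 1)
    (hom_ext fun m a => by
      change tmul R (op a • m) 1 = tmul R m a
      rw [smul_tmul, smul_eq_mul, mul_one])
    (by ext m; exact one_smul Rᵐᵒᵖ m)
  map_left r t := by
    change lift R _ _ (r • t) = r • lift R _ _ t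
    induction t using induction with
    | hz => simp
    | ht m a => exact (smul_comm r (op a) m).symm
    | ha a b h1 h2 => simp only [map_add, smul_add, h1, h2]
  map_right r t := by
    change lift R _ _ (op r • t) = op r • lift R _ _ t
    induction t using induction with
    | hz => simp
    | ht m a =>
      change op (a * r) • m = op r • op a • m
      rw [op_mul, mul_smul]
    | ha a b h1 h2 => simp only [map_add, smul_add, h1, h2]

@[simp] theorem lid_tmul (r : R) (m : M) : (lid R M).toAddEquiv (tmul R r m) = r • m := rfl

@[simp] theorem rid_tmul (r : R) (m : M) : (rid R M).toAddEquiv (tmul R m r) = op r • m := rfl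

end unit

end BTensor

/-- An `R`-bimodule `P` is invertible if `P ⊗_R Q ≃ R ≃ Q ⊗_R P` as bimodules for some
`R`-bimodule `Q`. -/
def IsInvertible (R : Type u) [Ring R] (P : Type u) [AddCommGroup P] [Module R P]
    [Module Rᵐᵒᵖ P] [SMulCommClass R Rᵐᵒᵖ P] : Prop :=
  ∃ (Q : Type u) (_ : AddCommGroup Q) (_ : Module R Q) (_ : Module Rᵐᵒᵖ Q)
    (_ : SMulCommClass R Rᵐᵒᵖ Q),
    Nonempty (BimodEquiv R (BTensor R P Q) R) ∧ Nonempty (BimodEquiv R (BTensor R Q P) R)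

section Invertible

open BTensor

variable {R : Type u} [Ring R] {P Q : Type u} [AddCommGroup P] [Module R P]
    [Module Rᵐᵒᵖ P] [SMulCommClass R Rᵐᵒᵖ P] [AddCommGroup Q] [Module R Q]
    [Module Rᵐᵒᵖ Q] [SMulCommClass R Rᵐᵒᵖ Q]

theorem IsInvertible.of_equiv (h : IsInvertible R P) (e : BimodEquiv R P Q) :
    IsInvertible R Q := by
  obtain ⟨T, _, _, _, _, ⟨a⟩, ⟨b⟩⟩ := h
  exact ⟨T, _, _, _, ‹_›, ⟨(congr R e.symm .refl).trans a⟩, ⟨(congr R .refl e.symm).trans b⟩⟩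

theorem IsInvertible.self (R : Type u) [Ring R] : IsInvertible R R :=
  ⟨R, _, _, _, inferInstance, ⟨lid R R⟩, ⟨lid R R⟩⟩

theorem IsInvertible.tensor (hP : IsInvertible R P) (hQ : IsInvertible R Q) :
    IsInvertible R (BTensor R P Q) := by
  obtain ⟨P', _, _, _, _, ⟨a⟩, ⟨b⟩⟩ := hP
  obtain ⟨Q', _, _, _, _, ⟨c⟩, ⟨d⟩⟩ := hQ
  refine ⟨BTensor R Q' P', inferInstance, inferInstance, inferInstance, inferInstance, ⟨?_⟩, ⟨?_⟩⟩
  · exact (assoc R P Q _).trans <| (congr R .refl ((assoc R Q Q' P').symm.trans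
      ((congr R c .refl).trans (lid R P')))).trans a
  · exact (assoc R Q' P' _).trans <| (congr R .refl ((assoc R P' P Q).symm.trans
      ((congr R b .refl).trans (lid R Q)))).trans d

end Invertible

/-! ### Pairings of an invertible bimodule with an inverse -/

/-- A strict Morita context between two `R`-bimodules, both of whose pairings are onto. -/
structure Pairing (R : Type*) [Ring R] (P Q : Type*) [AddCommGroup P] [Module R P]
    [Module Rᵐᵒᵖ P] [AddCommGroup Q] [Module R Q] [Module Rᵐᵒᵖ Q] where
  u : P →+ Q →+ R
  v : Q →+ P →+ R
  u_left : ∀ (r : R) p q, u (r • p) q = r * u p q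
  u_mid : ∀ (r : R) p q, u (op r • p) q = u p (r • q)
  u_right : ∀ (r : R) p q, u p (op r • q) = u p q * r
  v_left : ∀ (r : R) q p, v (r • q) p = r * v q p
  v_mid : ∀ (r : R) q p, v (op r • q) p = v q (r • p)
  v_right : ∀ (r : R) q p, v q (op r • p) = v q p * r
  u_smul : ∀ p q p', u p q • p' = op (v q p') • p
  v_smul : ∀ q p q', v q p • q' = op (u p q') • q
  u_one : ∃ s : Finset (P × Q), ∑ x ∈ s, u x.1 x.2 = 1
  v_one : ∃ s : Finset (Q × P), ∑ x ∈ s, v x.1 x.2 = 1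

namespace Pairing

variable {R : Type*} [Ring R] {P Q : Type*} [AddCommGroup P] [Module R P]
    [Module Rᵐᵒᵖ P] [AddCommGroup Q] [Module R Q] [Module Rᵐᵒᵖ Q]

/-- The same context with the two bimodules exchanged. -/
def swap (c : Pairing R P Q) : Pairing R Q P :=
  ⟨c.v, c.u, c.v_left, c.v_mid, c.v_right, c.u_left, c.u_mid, c.u_right, c.v_smul, c.u_smul,
    c.v_one, c.u_one⟩

theorem ext_right (c : Pairing R P Q) {y z : Q} (h : ∀ p, c.u p y = c.u p z) : y = z := by
  obtain ⟨s, hs⟩ := c.v_one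
  rw [← one_smul R y, ← one_smul R z, ← hs, Finset.sum_smul, Finset.sum_smul]
  exact Finset.sum_congr rfl fun x _ => by rw [c.v_smul, c.v_smul, h]

theorem ext_left (c : Pairing R P Q) {y z : P} (h : ∀ q, c.u y q = c.u z q) : y = z := by
  obtain ⟨s, hs⟩ := c.v_one
  rw [← one_smul Rᵐᵒᵖ y, ← one_smul Rᵐᵒᵖ z, ← op_one, ← hs, Finset.op_sum, Finset.sum_smul,
    Finset.sum_smul]
  exact Finset.sum_congr rfl fun x _ => by rw [← c.u_smul, ← c.u_smul, h]

end Pairing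

section

open BTensor

variable {R : Type*} [Ring R] {P Q : Type*} [AddCommGroup P] [Module R P]
    [Module Rᵐᵒᵖ P] [SMulCommClass R Rᵐᵒᵖ P] [AddCommGroup Q] [Module R Q]
    [Module Rᵐᵒᵖ Q] [SMulCommClass R Rᵐᵒᵖ Q]

theorem exists_finset (t : BTensor R P Q) :
    ∃ s : Finset (P × Q), ∑ x ∈ s, tmul R x.1 x.2 = t := by
  obtain ⟨t, rfl⟩ : ∃ t', proj R P Q t' = t :=
    QuotientAddGroup.mk'_surjective (balanced R P Q) t
  obtain ⟨s, rfl⟩ := TensorProduct.exists_finset t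
  exact ⟨s, (map_sum (proj R P Q) _ _).symm⟩

theorem exists_pairing (a : BimodEquiv R (BTensor R P Q) R) (b : BimodEquiv R (BTensor R Q P) R) :
    Nonempty (Pairing R P Q) := by
  let F₁ : BimodEquiv R (BTensor R P (BTensor R Q P)) P := (congr R .refl b).trans (rid R P)
  let F₂ : BimodEquiv R (BTensor R P (BTensor R Q P)) P :=
    (assoc R P Q P).symm.trans ((congr R a .refl).trans (lid R P))
  let θ : BimodEquiv R P P := F₂.symm.trans F₁
  let b' : BimodEquiv R (BTensor R Q P) R := (congr R .refl θ.symm).trans b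
  have key : ∀ p q p', a.toAddEquiv (tmul R p q) • θ.toAddEquiv p' =
      op (b.toAddEquiv (tmul R q p')) • p := by
    intro p q p'
    have h3 : F₂.toAddEquiv (tmul R p (tmul R q p')) = a.toAddEquiv (tmul R p q) • p' := rfl
    have h4 : ∀ t, θ.toAddEquiv (F₂.toAddEquiv t) = F₁.toAddEquiv t := fun t =>
      congrArg F₁.toAddEquiv (F₂.toAddEquiv.symm_apply_apply t)
    rw [← θ.left, ← h3, h4]
    rfl
  have h1 : ∀ p q p', a.toAddEquiv (tmul R p q) • p' =
      op (b'.toAddEquiv (tmul R q p')) • p := by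
    intro p q p'
    rw [← θ.toAddEquiv.apply_symm_apply p', key]
    rw [θ.toAddEquiv.apply_symm_apply p']
    rfl
  have nd : ∀ x y : Q, (∀ p, a.toAddEquiv (tmul R p x) = a.toAddEquiv (tmul R p y)) → x = y := by
    intro x y hxy
    have h2 : ∀ t : BTensor R Q P, b'.toAddEquiv t • x = b'.toAddEquiv t • y := by
      intro t
      induction t using BTensor.induction with
      | hz => simp
      | ht q p =>
        have h3 : ∀ z, b'.toAddEquiv (tmul R q p) • z = (lid R Q).toAddEquiv
          ((congr R b' .refl).toAddEquiv ((assoc R Q P Q).toAddEquiv.symm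
            (tmul R q (tmul R p z)))) := fun z => rfl
        rw [h3, h3, a.toAddEquiv.injective (hxy p)]
      | ha s t h1 h2 => rw [map_add, add_smul, add_smul, h1, h2]
    simpa using h2 (b'.toAddEquiv.symm 1)
  obtain ⟨s, hs⟩ := exists_finset (a.toAddEquiv.symm 1)
  obtain ⟨s', hs'⟩ := exists_finset (b'.toAddEquiv.symm 1)
  refine ⟨⟨(mkHom R).compr₂ a.toAddEquiv.toAddMonoidHom, (mkHom R).compr₂ b'.toAddEquiv.toAddMonoidHom,
    fun r p q => a.left r (tmul R p q), fun r p q => congrArg a.toAddEquiv (smul_tmul R r p q),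
    fun r p q => a.right r (tmul R p q),
    fun r p q => b'.left r (tmul R p q), fun r p q => congrArg b'.toAddEquiv (smul_tmul R r p q),
    fun r p q => b'.right r (tmul R p q), h1, fun q p q' => nd _ _ fun p' => ?_,
    ⟨s, ?_⟩, ⟨s', ?_⟩⟩⟩
  · change a.toAddEquiv (tmul R p' (b'.toAddEquiv (tmul R q p) • q')) =
      a.toAddEquiv (tmul R p' (op (a.toAddEquiv (tmul R p q')) • q))
    rw [← smul_tmul, ← h1, ← smul_tmul_left, a.left, ← smul_tmul_right, a.right]
    rfl
  · apply a.toAddEquiv.symm.injective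
    rw [← hs, map_sum]
    exact Finset.sum_congr rfl fun x _ => a.toAddEquiv.symm_apply_apply _
  · apply b'.toAddEquiv.symm.injective
    rw [← hs', map_sum]
    exact Finset.sum_congr rfl fun x _ => b'.toAddEquiv.symm_apply_apply _

end

/-! ### The category `M(S/R)` and the group `P(S/R)` -/

section Arrow

variable {R : Type u} {S : Type v} [Ring R] [Ring S]

/-- An `S`-bimodule regarded as an `R`-bimodule along `ι : R → S`. -/
def Res (_ι : R →+* S) (X : Type w) : Type w := X

namespace Res

variable (ι : R →+* S) (X : Type w) [AddCommGroup X]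

instance : AddCommGroup (Res ι X) := inferInstanceAs (AddCommGroup X)

instance [Module S X] : Module R (Res ι X) := Module.compHom X ι

instance [Module Sᵐᵒᵖ X] : Module Rᵐᵒᵖ (Res ι X) := Module.compHom X ι.op

instance [Module S X] [Module Sᵐᵒᵖ X] [SMulCommClass S Sᵐᵒᵖ X] :
    SMulCommClass R Rᵐᵒᵖ (Res ι X) where
  smul_comm r s x := smul_comm (ι r) (op (ι s.unop)) (show X from x)

end Res

/-- An `R`-bimodule `P`, an `S`-bimodule `X` and an `R`-bilinear map `φ : P → X`, where `S` is
a ring extension of `R` through `ι`. -/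
structure BimodArrow (ι : R →+* S) where
  P : Type u
  X : Type v
  [acgP : AddCommGroup P]
  [leftP : Module R P]
  [rightP : Module Rᵐᵒᵖ P]
  [commP : SMulCommClass R Rᵐᵒᵖ P]
  [acgX : AddCommGroup X]
  [leftX : Module S X]
  [rightX : Module Sᵐᵒᵖ X]
  [commX : SMulCommClass S Sᵐᵒᵖ X]
  φ : P →+ X
  map_left : ∀ (r : R) p, φ (r • p) = ι r • φ p
  map_right : ∀ (r : R) p, φ (op r • p) = op (ι r) • φ p

attribute [instance] BimodArrow.acgP BimodArrow.leftP BimodArrow.rightP BimodArrow.commP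
  BimodArrow.acgX BimodArrow.leftX BimodArrow.rightX BimodArrow.commX

namespace BimodArrow

open BTensor

variable {ι : R →+* S}

/-- The map `P ⊗_R S → X`, `p ⊗ s ↦ φ(p) s`. -/
def rMap (o : BimodArrow ι) : BTensor R o.P (Res ι S) →+ o.X :=
  lift R (show o.P →+ Res ι S →+ o.X from
      (((smulAddHom Sᵐᵒᵖ o.X).comp (opAddEquiv (α := S)).toAddMonoidHom).flip).comp o.φ)
    (fun p r (s : S) => by
      change op s • o.φ (op r • p) = op (ι r * s) • o.φ p
      rw [o.map_right, op_mul, mul_smul])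

/-- The map `S ⊗_R P → X`, `s ⊗ p ↦ s φ(p)`. -/
def lMap (o : BimodArrow ι) : BTensor R (Res ι S) o.P →+ o.X :=
  lift R (show Res ι S →+ o.P →+ o.X from (smulAddHom S o.X).compl₂ o.φ)
    (fun (s : S) r p => by
      change (s * ι r) • o.φ p = s • o.φ (r • p)
      rw [o.map_left, mul_smul])

theorem rMap_tmul (o : BimodArrow ι) (p : o.P) (s : S) :
    o.rMap (tmul R (N := Res ι S) p s) = op s • o.φ p := rfl

theorem lMap_tmul (o : BimodArrow ι) (p : o.P) (s : S) :
    o.lMap (tmul R (M := Res ι S) s p) = s • o.φ p := rfl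

/-- `φ : P → X` is an object of `M(S/R)` with `P` and `X` invertible. -/
structure IsPicard (o : BimodArrow ι) : Prop where
  rMap_bijective : Function.Bijective o.rMap
  lMap_bijective : Function.Bijective o.lMap
  invertible_P : IsInvertible R o.P
  invertible_X : IsInvertible S o.X

/-- Isomorphisms in `M(S/R)`: commutative squares of bimodule isomorphisms. -/
structure Iso (o o' : BimodArrow ι) where
  e : BimodEquiv R o.P o'.P
  f : BimodEquiv S o.X o'.X
  comm : ∀ p, f.toAddEquiv (o.φ p) = o'.φ (e.toAddEquiv p)

/-- The identity. -/
def Iso.refl (o : BimodArrow ι) : Iso o o := ⟨.refl, .refl, fun _ => rfl⟩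

/-- The inverse isomorphism. -/
def Iso.symm {o o' : BimodArrow ι} (i : Iso o o') : Iso o' o :=
  ⟨i.e.symm, i.f.symm, fun p => by
    change i.f.toAddEquiv.symm (o'.φ p) = o.φ (i.e.toAddEquiv.symm p)
    rw [AddEquiv.symm_apply_eq, i.comm, AddEquiv.apply_symm_apply]⟩

/-- The composition of isomorphisms. -/
def Iso.trans {o o' o'' : BimodArrow ι} (i : Iso o o') (j : Iso o' o'') : Iso o o'' :=
  ⟨i.e.trans j.e, i.f.trans j.f, fun p => by
    change j.f.toAddEquiv (i.f.toAddEquiv (o.φ p)) = _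
    rw [i.comm, j.comm]; rfl⟩

variable (ι) in
/-- The inclusion `R → S`. -/
abbrev unit : BimodArrow ι where
  P := R
  X := S
  φ := ι.toAddMonoidHom
  map_left r p := map_mul ι r p
  map_right r p := map_mul ι p r

/-- The map `φ ⊗ ψ : P ⊗_R Q → X ⊗_S Y`, `p ⊗ q ↦ φ(p) ⊗ ψ(q)`. -/
def tensorHom (o o' : BimodArrow ι) : BTensor R o.P o'.P →+ BTensor S o.X o'.X :=
  lift R (((mkHom S).comp o.φ).compl₂ o'.φ) (fun p r q => by
    change tmul S (o.φ (op r • p)) (o'.φ q) = tmul S (o.φ p) (o'.φ (r • q))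
    rw [o.map_right, o'.map_left, smul_tmul])

theorem tensorHom_tmul (o o' : BimodArrow ι) (p : o.P) (q : o'.P) :
    o.tensorHom o' (tmul R p q) = tmul S (o.φ p) (o'.φ q) := rfl

/-- The product `φ ⊗ ψ : P ⊗_R Q → X ⊗_S Y`. -/
abbrev tensor (o o' : BimodArrow ι) : BimodArrow ι where
  P := BTensor R o.P o'.P
  X := BTensor S o.X o'.X
  φ := tensorHom o o'
  map_left r t := by
    induction t using BTensor.induction with
    | hz => simp
    | ht p q => exact congrArg (tmul S · (o'.φ q)) (o.map_left r p)
    | ha a b h1 h2 => simp only [map_add, smul_add, h1, h2]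
  map_right r t := by
    induction t using BTensor.induction with
    | hz => simp
    | ht p q => exact congrArg (tmul S (o.φ p) ·) (o'.map_right r q)
    | ha a b h1 h2 => simp only [map_add, smul_add, h1, h2]

/-- The product of isomorphisms. -/
def Iso.tensor {a a' b b' : BimodArrow ι} (i : Iso a a') (j : Iso b b') :
    Iso (a.tensor b) (a'.tensor b') :=
  ⟨congr R i.e j.e, congr S i.f j.f, fun t => by
    have h : (congr S i.f j.f).toAddEquiv.toAddMonoidHom.comp (tensorHom a b) =
        (tensorHom a' b').comp (congr R i.e j.e).toAddEquiv.toAddMonoidHom :=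
      hom_ext fun p q => congrArg₂ (tmul S) (i.comm p) (j.comm q)
    exact DFunLike.congr_fun h t⟩

/-- Associativity of the product. -/
def tensorAssoc (a b c : BimodArrow ι) :
    Iso ((a.tensor b).tensor c) (a.tensor (b.tensor c)) :=
  ⟨assoc R _ _ _, assoc S _ _ _, fun t => by
    have h : (assoc S a.X b.X c.X).toAddEquiv.toAddMonoidHom.comp (tensorHom (a.tensor b) c) =
        (tensorHom a (b.tensor c)).comp (assoc R a.P b.P c.P).toAddEquiv.toAddMonoidHom :=
      hom_ext₂ fun p q r => rfl
    exact DFunLike.congr_fun h t⟩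

/-- The inclusion is a left unit. -/
def unitTensor (a : BimodArrow ι) : Iso ((unit ι).tensor a) a :=
  ⟨lid R a.P, lid S a.X, fun t => by
    have h : (lid S a.X).toAddEquiv.toAddMonoidHom.comp (tensorHom (unit ι) a) =
        a.φ.comp (lid R a.P).toAddEquiv.toAddMonoidHom :=
      hom_ext fun r p => (a.map_left r p).symm
    exact DFunLike.congr_fun h t⟩

/-- The inclusion is a right unit. -/
def tensorUnit (a : BimodArrow ι) : Iso (a.tensor (unit ι)) a :=
  ⟨rid R a.P, rid S a.X, fun t => by
    have h : (rid S a.X).toAddEquiv.toAddMonoidHom.comp (tensorHom a (unit ι)) =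
        a.φ.comp (rid R a.P).toAddEquiv.toAddMonoidHom :=
      hom_ext fun p r => (a.map_right r p).symm
    exact DFunLike.congr_fun h t⟩

end BimodArrow
end Arrow

section Group

open BTensor

variable {R : Type u} {S : Type v} [Ring R] [Ring S] {ι : R →+* S}

namespace BimodArrow

theorem Iso.isPicard {o o' : BimodArrow ι} (i : Iso o o') (h : o.IsPicard) : o'.IsPicard := by
  refine ⟨?_, ?_, h.invertible_P.of_equiv i.e, h.invertible_X.of_equiv i.f⟩
  · let c := congrAdd R (N := Res ι S) i.e.toAddEquiv (AddEquiv.refl _) i.e.right (fun _ _ => rfl)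
    have h1 : o'.rMap.comp c.toAddMonoidHom = i.f.toAddEquiv.toAddMonoidHom.comp o.rMap :=
      hom_ext fun p (s : S) => by
        change op s • o'.φ (i.e.toAddEquiv p) = i.f.toAddEquiv (op s • o.φ p)
        rw [i.f.right, i.comm]
    have h2 : (o'.rMap ∘ c : _ → _) = i.f.toAddEquiv ∘ o.rMap := congrArg DFunLike.coe h1
    rw [← c.bijective.of_comp_iff, h2]
    exact i.f.toAddEquiv.bijective.comp h.rMap_bijective
  · let c := congrAdd R (M := Res ι S) (AddEquiv.refl _) i.e.toAddEquiv (fun _ _ => rfl) i.e.left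
    have h1 : o'.lMap.comp c.toAddMonoidHom = i.f.toAddEquiv.toAddMonoidHom.comp o.lMap :=
      hom_ext fun (s : S) p => by
        change s • o'.φ (i.e.toAddEquiv p) = i.f.toAddEquiv (s • o.φ p)
        rw [i.f.left, i.comm]
    have h2 : (o'.lMap ∘ c : _ → _) = i.f.toAddEquiv ∘ o.lMap := congrArg DFunLike.coe h1
    rw [← c.bijective.of_comp_iff, h2]
    exact i.f.toAddEquiv.bijective.comp h.lMap_bijective

theorem isPicard_unit : (unit ι).IsPicard := by
  refine ⟨?_, ?_, .self R, .self S⟩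
  · have h : (unit ι).rMap = (lid R (Res ι S)).toAddEquiv.toAddMonoidHom :=
      hom_ext fun r s => rfl
    rw [h]
    exact (lid R (Res ι S)).toAddEquiv.bijective
  · have h : (unit ι).lMap = (rid R (Res ι S)).toAddEquiv.toAddMonoidHom :=
      hom_ext fun r s => rfl
    rw [h]
    exact (rid R (Res ι S)).toAddEquiv.bijective

theorem lMap_smul (o : BimodArrow ι) (s : S) (t : BTensor R (Res ι S) o.P) :
    s • o.lMap t = o.lMap (map R (show Res ι S →+ Res ι S from AddMonoidHom.mulLeft s)
      (AddMonoidHom.id _) (fun r a => (mul_assoc s (show S from a) (ι r)).symm)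
      (fun _ _ => rfl) t) := by
  induction t using BTensor.induction with
  | hz => simp
  | ht a p => exact (mul_smul s (show S from a) (o.φ p)).symm
  | ha a b h1 h2 => rw [map_add, smul_add, h1, h2, map_add, map_add]

theorem rMap_smul (o : BimodArrow ι) (s : S) (t : BTensor R o.P (Res ι S)) :
    op s • o.rMap t = o.rMap (map R (AddMonoidHom.id _)
      (show Res ι S →+ Res ι S from AddMonoidHom.mulRight s) (fun _ _ => rfl)
      (fun r a => mul_assoc (ι r) (show S from a) s) t) := by
  induction t using BTensor.induction with
  | hz => simp
  | ht p a =>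
    change op s • op (show S from a) • o.φ p = op ((show S from a) * s) • o.φ p
    rw [op_mul, mul_smul]
  | ha a b h1 h2 => rw [map_add, smul_add, h1, h2, map_add, map_add]

/-- The map `X ⊗_R P' → X ⊗_S X'`, `x ⊗ p ↦ x ⊗ φ'(p)`. -/
def extendR (X : Type*) [AddCommGroup X] [Module Sᵐᵒᵖ X] (o : BimodArrow ι) :
    BTensor R (Res ι X) o.P →+ BTensor S X o.X :=
  lift R (show Res ι X →+ o.P →+ BTensor S X o.X from
      (mkHom S (M := X) (N := o.X)).compl₂ o.φ)
    (fun (x : X) r p => by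
      change tmul S (op (ι r) • x) (o.φ p) = tmul S x (o.φ (r • p))
      rw [smul_tmul, o.map_left])

theorem extendR_bijective (X : Type*) [AddCommGroup X] [Module Sᵐᵒᵖ X] (o : BimodArrow ι)
    (h : Function.Bijective o.lMap) : Function.Bijective (extendR X o) := by
  let l := AddEquiv.ofBijective o.lMap h
  let J : X →+ BTensor R (Res ι S) o.P →+ BTensor R (Res ι X) o.P :=
    AddMonoidHom.mk' (fun x => map R
        (show Res ι S →+ Res ι X from (show S →+ X from AddMonoidHom.mk' (fun s : S => op s • x)
          (fun a b => by rw [op_add, add_smul]))) (AddMonoidHom.id _)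
        (fun r (s : S) => by
          change op (s * ι r) • x = op (ι r) • op s • x
          rw [op_mul, mul_smul]) (fun _ _ => rfl))
      (fun x y => hom_ext fun (s : S) p =>
        (congrArg (tmul R (M := Res ι X) · p) (smul_add (op s) x y)).trans (add_tmul R _ _ _))
  have hJ : ∀ x (s : S) y, J (op s • x) (l.symm y) = J x (l.symm (s • y)) := by
    intro x s y
    obtain ⟨t, rfl⟩ := l.surjective y
    have h1 : s • l t = l (map R (show Res ι S →+ Res ι S from AddMonoidHom.mulLeft s)
      (AddMonoidHom.id _) (fun r a => (mul_assoc s (show S from a) (ι r)).symm)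
      (fun _ _ => rfl) t) := o.lMap_smul s t
    rw [h1, l.symm_apply_apply, l.symm_apply_apply]
    clear h1
    induction t using BTensor.induction with
    | hz => simp
    | ht a p =>
      refine congrArg (tmul R (M := Res ι X) · p) ?_
      change op (show S from a) • op s • x = op (s * (show S from a)) • x
      rw [op_mul, mul_smul]
    | ha a b h1 h2 =>
      rw [map_add, map_add, map_add, h1, h2]
  let g : BTensor S X o.X →+ BTensor R (Res ι X) o.P :=
    lift S (J.compl₂ l.symm.toAddMonoidHom) hJ
  have h1 : g.comp (extendR X o) = AddMonoidHom.id _ := hom_ext fun x p => by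
    change J x (l.symm (o.φ p)) = tmul R x p
    have : o.φ p = l (tmul R (M := Res ι S) (1 : S) p) := (one_smul S _).symm
    rw [this, l.symm_apply_apply]
    exact congrArg (tmul R (M := Res ι X) · p) (one_smul Sᵐᵒᵖ (show X from x))
  have h2 : (extendR X o).comp g = AddMonoidHom.id _ := hom_ext fun x y => by
    change extendR X o (J x (l.symm y)) = tmul S x y
    obtain ⟨t, rfl⟩ := l.surjective y
    rw [l.symm_apply_apply]
    induction t using BTensor.induction with
    | hz => simp
    | ht a p => exact smul_tmul S (show S from a) x (o.φ p)
    | ha a b h1 h2 => rw [map_add, map_add, map_add, h1, h2, tmul_add]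
  exact (AddMonoidHom.toAddEquiv _ _ h1 h2).bijective

/-- The map `P ⊗_R Y → X ⊗_S Y`, `p ⊗ y ↦ φ(p) ⊗ y`. -/
def extendL (Y : Type*) [AddCommGroup Y] [Module S Y] (o : BimodArrow ι) :
    BTensor R o.P (Res ι Y) →+ BTensor S o.X Y :=
  lift R (show o.P →+ Res ι Y →+ BTensor S o.X Y from
      (mkHom S (M := o.X) (N := Y)).comp o.φ)
    (fun p r (y : Y) => by
      change tmul S (o.φ (op r • p)) y = tmul S (o.φ p) (ι r • y)
      rw [← smul_tmul, o.map_right])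

theorem extendL_bijective (Y : Type*) [AddCommGroup Y] [Module S Y] (o : BimodArrow ι)
    (h : Function.Bijective o.rMap) : Function.Bijective (extendL Y o) := by
  let l := AddEquiv.ofBijective o.rMap h
  let J : Y →+ BTensor R o.P (Res ι S) →+ BTensor R o.P (Res ι Y) :=
    AddMonoidHom.mk' (fun y => map R (AddMonoidHom.id _)
        (show Res ι S →+ Res ι Y from (show S →+ Y from AddMonoidHom.mk' (fun s : S => s • y)
          (fun a b => by rw [add_smul])))
        (fun _ _ => rfl) (fun r (s : S) => by
          change (ι r * s) • y = ι r • s • y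
          rw [mul_smul]))
      (fun x y => hom_ext fun p (s : S) =>
        (congrArg (tmul R (N := Res ι Y) p ·) (smul_add s x y)).trans (tmul_add R _ _ _))
  have hJ : ∀ x (s : S) y, J y (l.symm (op s • x)) = J (s • y) (l.symm x) := by
    intro x s y
    obtain ⟨t, rfl⟩ := l.surjective x
    have h1 : op s • l t = l (map R (AddMonoidHom.id _)
      (show Res ι S →+ Res ι S from AddMonoidHom.mulRight s) (fun _ _ => rfl)
      (fun r a => mul_assoc (ι r) (show S from a) s) t) := o.rMap_smul s t
    rw [h1, l.symm_apply_apply, l.symm_apply_apply]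
    clear h1
    induction t using BTensor.induction with
    | hz => simp
    | ht p a =>
      refine congrArg (tmul R (N := Res ι Y) p ·) ?_
      change ((show S from a) * s) • y = (show S from a) • s • y
      rw [mul_smul]
    | ha a b h1 h2 =>
      rw [map_add, map_add, map_add, h1, h2]
  let g : BTensor S o.X Y →+ BTensor R o.P (Res ι Y) :=
    lift S (J.compl₂ l.symm.toAddMonoidHom).flip hJ
  have h1 : g.comp (extendL Y o) = AddMonoidHom.id _ := hom_ext fun p y => by
    change J y (l.symm (o.φ p)) = tmul R p y
    have : o.φ p = l (tmul R (N := Res ι S) p (1 : S)) := (one_smul Sᵐᵒᵖ _).symm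
    rw [this, l.symm_apply_apply]
    exact congrArg (tmul R (N := Res ι Y) p ·) (one_smul S (show Y from y))
  have h2 : (extendL Y o).comp g = AddMonoidHom.id _ := hom_ext fun x y => by
    change extendL Y o (J y (l.symm x)) = tmul S x y
    obtain ⟨t, rfl⟩ := l.surjective x
    rw [l.symm_apply_apply]
    induction t using BTensor.induction with
    | hz => simp
    | ht p a => exact (smul_tmul S (show S from a) (o.φ p) y).symm
    | ha a b h1 h2 => rw [map_add, map_add, map_add, h1, h2, add_tmul]
  exact (AddMonoidHom.toAddEquiv _ _ h1 h2).bijective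

theorem lMap_right (o : BimodArrow ι) (r : R) (t : BTensor R (Res ι S) o.P) :
    o.lMap (op r • t) = op (ι r) • o.lMap t := by
  induction t using BTensor.induction with
  | hz => simp
  | ht a p =>
    change (show S from a) • o.φ (op r • p) = op (ι r) • (show S from a) • o.φ p
    rw [o.map_right]
    exact smul_comm (show S from a) (op (ι r)) (o.φ p)
  | ha a b h1 h2 => rw [smul_add, map_add, map_add, smul_add, h1, h2]

theorem rMap_left (o : BimodArrow ι) (r : R) (t : BTensor R o.P (Res ι S)) :
    o.rMap (r • t) = ι r • o.rMap t := by
  induction t using BTensor.induction with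
  | hz => simp
  | ht p a =>
    change op (show S from a) • o.φ (r • p) = ι r • op (show S from a) • o.φ p
    rw [o.map_left]
    exact (smul_comm (ι r) (op (show S from a)) (o.φ p)).symm
  | ha a b h1 h2 => rw [smul_add, map_add, map_add, smul_add, h1, h2]

theorem IsPicard.tensor {a b : BimodArrow ι} (ha : a.IsPicard) (hb : b.IsPicard) :
    (a.tensor b).IsPicard := by
  refine ⟨?_, ?_, ha.invertible_P.tensor hb.invertible_P, ha.invertible_X.tensor hb.invertible_X⟩
  · let e₁ := assocAdd R a.P b.P (Res ι S)
    let e₂ : BTensor R a.P (BTensor R b.P (Res ι S)) ≃+ BTensor R a.P (Res ι b.X) :=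
      congrAdd R (AddEquiv.refl _) (AddEquiv.ofBijective b.rMap hb.rMap_bijective)
        (fun _ _ => rfl) b.rMap_left
    have h : (a.tensor b).rMap = ((extendL b.X a).comp e₂.toAddMonoidHom).comp
        e₁.toAddMonoidHom :=
      hom_ext₂ fun p q s => rfl
    rw [h]
    exact ((extendL_bijective b.X a ha.rMap_bijective).comp e₂.bijective).comp e₁.bijective
  · let e₁ := assocAdd R (Res ι S) a.P b.P
    let e₂ : BTensor R (BTensor R (Res ι S) a.P) b.P ≃+ BTensor R (Res ι a.X) b.P :=
      congrAdd R (AddEquiv.ofBijective a.lMap ha.lMap_bijective) (AddEquiv.refl _)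
        a.lMap_right (fun _ _ => rfl)
    have h : (a.tensor b).lMap.comp e₁.toAddMonoidHom =
        (extendR a.X b).comp e₂.toAddMonoidHom :=
      hom_ext₂ fun s p q => rfl
    have h' : (a.tensor b).lMap ∘ e₁ = extendR a.X b ∘ e₂ := congrArg DFunLike.coe h
    rw [← e₁.bijective.of_comp_iff, h']
    exact (extendR_bijective a.X b hb.lMap_bijective).comp e₂.bijective

end BimodArrow
end Group

section Dual

open BTensor

namespace Pairing

variable {R : Type*} [Ring R] {P Q : Type*} [AddCommGroup P] [Module R P]
    [Module Rᵐᵒᵖ P] [SMulCommClass R Rᵐᵒᵖ P] [AddCommGroup Q] [Module R Q]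
    [Module Rᵐᵒᵖ Q] [SMulCommClass R Rᵐᵒᵖ Q]

/-- The map `P ⊗_R Q → R` given by the first pairing. -/
def hom (c : Pairing R P Q) : BTensor R P Q →+ R := lift R c.u (fun p r q => c.u_mid r p q)

/-- The isomorphism `P ⊗_R Q ≃ R`. -/
noncomputable def equiv (c : Pairing R P Q) : BimodEquiv R (BTensor R P Q) R := by
  refine .ofBijective c.hom ?_ ?_ ?_
  · intro r t
    induction t using BTensor.induction with
    | hz => simp
    | ht p q => exact c.u_left r p q
    | ha a b h1 h2 => simp only [map_add, smul_add, h1, h2]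
  · intro r t
    induction t using BTensor.induction with
    | hz => simp
    | ht p q => exact c.u_right r p q
    | ha a b h1 h2 => simp only [map_add, smul_add, h1, h2]
  · obtain ⟨s, hs⟩ := c.u_one
    have hadd : ∀ a b : R, (∑ x ∈ s, tmul R ((a + b) • x.1) x.2) =
        (∑ x ∈ s, tmul R (a • x.1) x.2) + ∑ x ∈ s, tmul R (b • x.1) x.2 := fun a b => by
      rw [← Finset.sum_add_distrib]
      exact Finset.sum_congr rfl fun x _ => by rw [add_smul, add_tmul]
    let g : R →+ BTensor R P Q := AddMonoidHom.mk' (fun r => ∑ x ∈ s, tmul R (r • x.1) x.2) hadd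
    refine (AddMonoidHom.toAddEquiv c.hom g (hom_ext fun p q => ?_) ?_).bijective
    · change ∑ x ∈ s, tmul R (c.u p q • x.1) x.2 = tmul R p q
      have h : ∀ x ∈ s, tmul R (c.u p q • x.1) x.2 = mkHom R p (op (c.u x.1 x.2) • q) :=
        fun x _ => by rw [c.u_smul, smul_tmul, c.v_smul]; rfl
      rw [Finset.sum_congr rfl h, ← map_sum, ← Finset.sum_smul, ← Finset.op_sum, hs, op_one,
        one_smul]; rfl
    · ext r
      change c.hom (∑ x ∈ s, tmul R (r • x.1) x.2) = r
      rw [map_sum]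
      have h : ∀ x ∈ s, c.hom (tmul R (r • x.1) x.2) =
        r * c.u x.1 x.2 := fun x _ => c.u_left r x.1 x.2
      rw [Finset.sum_congr rfl h, ← Finset.mul_sum, hs, mul_one]

theorem equiv_tmul (c : Pairing R P Q) (p : P) (q : Q) :
    c.equiv.toAddEquiv (tmul R p q) = c.u p q := rfl

end Pairing

variable {R : Type u} {S : Type v} [Ring R] [Ring S] {ι : R →+* S}

namespace BimodArrow

/-- Compatible Morita contexts between two objects of `M(S/R)`. -/
structure Dual (o o' : BimodArrow ι) where
  c : Pairing R o.P o'.P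
  C : Pairing S o.X o'.X
  hu : ∀ p q, C.u (o.φ p) (o'.φ q) = ι (c.u p q)
  hv : ∀ q p, C.v (o'.φ q) (o.φ p) = ι (c.v q p)

namespace Dual

variable {o o' : BimodArrow ι}

/-- The contexts with the two objects exchanged. -/
def swap (d : Dual o o') : Dual o' o := ⟨d.c.swap, d.C.swap, d.hv, d.hu⟩

/-- The isomorphism `o ⊗ o' ≃ (R → S)`. -/
noncomputable def iso (d : Dual o o') : Iso (o.tensor o') (unit ι) :=
  ⟨d.c.equiv, d.C.equiv, fun t => by
    have h : d.C.equiv.toAddEquiv.toAddMonoidHom.comp (tensorHom o o') =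
        ι.toAddMonoidHom.comp d.c.equiv.toAddEquiv.toAddMonoidHom :=
      hom_ext fun p q => by
        change d.C.equiv.toAddEquiv (tmul S (o.φ p) (o'.φ q)) =
          ι (d.c.equiv.toAddEquiv (tmul R p q))
        rw [Pairing.equiv_tmul, Pairing.equiv_tmul, d.hu]
    exact DFunLike.congr_fun h t⟩

theorem lMap_bijective (d : Dual o o') : Function.Bijective o.lMap := by
  obtain ⟨s, hs⟩ := d.c.v_one
  let g : o.X →+ BTensor R (Res ι S) o.P :=
    ∑ y ∈ s, ((mkHom R (M := Res ι S) (N := o.P)).flip y.2).comp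
      (show o.X →+ Res ι S from d.C.u.flip (o'.φ y.1))
  have hg : ∀ x, g x = ∑ y ∈ s, tmul R (M := Res ι S) (d.C.u x (o'.φ y.1)) y.2 := fun x =>
    AddMonoidHom.finsetSum_apply _ _ _
  refine (AddMonoidHom.toAddEquiv o.lMap g (hom_ext fun a p => ?_) ?_).bijective
  · change g ((show S from a) • o.φ p) = tmul R a p
    rw [hg]
    have h : ∀ y ∈ s, tmul R (M := Res ι S) (d.C.u ((show S from a) • o.φ p) (o'.φ y.1)) y.2 =
        mkHom R (M := Res ι S) a (op (d.c.v y.1 y.2) • p) := fun y _ => by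
      rw [d.C.u_left, d.hu, ← d.c.u_smul]
      exact smul_tmul R (M := Res ι S) (d.c.u p y.1) a y.2
    rw [Finset.sum_congr rfl h, ← map_sum, ← Finset.sum_smul, ← Finset.op_sum, hs, op_one,
      one_smul]; rfl
  · ext x
    change o.lMap (g x) = x
    rw [hg, map_sum]
    have h : ∀ y ∈ s, o.lMap (tmul R (M := Res ι S) (d.C.u x (o'.φ y.1)) y.2) =
        op (ι (d.c.v y.1 y.2)) • x := fun y _ => by
      rw [← d.hv, ← d.C.u_smul]; rfl
    rw [Finset.sum_congr rfl h, ← Finset.sum_smul, ← Finset.op_sum, ← map_sum, hs, map_one,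
      op_one, one_smul]

theorem rMap_bijective (d : Dual o o') : Function.Bijective o.rMap := by
  obtain ⟨s, hs⟩ := d.c.u_one
  let g : o.X →+ BTensor R o.P (Res ι S) :=
    ∑ y ∈ s, (mkHom R (N := Res ι S) y.1).comp
      (show o.X →+ Res ι S from d.C.v (o'.φ y.2))
  have hg : ∀ x, g x = ∑ y ∈ s, tmul R (N := Res ι S) y.1 (d.C.v (o'.φ y.2) x) := fun x =>
    AddMonoidHom.finsetSum_apply _ _ _
  refine (AddMonoidHom.toAddEquiv o.rMap g (hom_ext fun p a => ?_) ?_).bijective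
  · change g (op (show S from a) • o.φ p) = tmul R p a
    rw [hg]
    have h : ∀ y ∈ s, tmul R (N := Res ι S) y.1
        (d.C.v (o'.φ y.2) (op (show S from a) • o.φ p)) =
        (mkHom R (N := Res ι S)).flip a (d.c.u y.1 y.2 • p) := fun y _ => by
      rw [d.C.v_right, d.hv, d.c.u_smul]
      exact (smul_tmul R (N := Res ι S) (d.c.v y.2 p) y.1 a).symm
    rw [Finset.sum_congr rfl h, ← map_sum, ← Finset.sum_smul, hs, one_smul]; rfl
  · ext x
    change o.rMap (g x) = x
    rw [hg, map_sum]
    have h : ∀ y ∈ s, o.rMap (tmul R (N := Res ι S) y.1 (d.C.v (o'.φ y.2) x)) =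
        ι (d.c.u y.1 y.2) • x := fun y _ => by
      rw [← d.hu, d.C.u_smul]; rfl
    rw [Finset.sum_congr rfl h, ← Finset.sum_smul, ← map_sum, hs, map_one, one_smul]

theorem isPicard (d : Dual o o') : o.IsPicard :=
  ⟨d.rMap_bijective, d.lMap_bijective,
    ⟨o'.P, _, _, _, inferInstance, ⟨d.c.equiv⟩, ⟨d.c.swap.equiv⟩⟩,
    ⟨o'.X, _, _, _, inferInstance, ⟨d.C.equiv⟩, ⟨d.C.swap.equiv⟩⟩⟩

end Dual

theorem IsPicard.exists_dual {o : BimodArrow ι} (h : o.IsPicard) :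
    ∃ o' : BimodArrow ι, Nonempty (Dual o o') := by
  obtain ⟨Q, _, _, _, _, ⟨a⟩, ⟨b⟩⟩ := h.invertible_P
  obtain ⟨Y, _, _, _, _, ⟨a'⟩, ⟨b'⟩⟩ := h.invertible_X
  obtain ⟨c⟩ := exists_pairing a b
  obtain ⟨C⟩ := exists_pairing a' b'
  have hext : ∀ y y', (∀ p, C.u (o.φ p) y = C.u (o.φ p) y') → y = y' := by
    intro y y' hy
    refine C.ext_right fun x => ?_
    obtain ⟨t, rfl⟩ := h.lMap_bijective.2 x
    induction t using BTensor.induction with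
    | hz => simp
    | ht s p =>
      change C.u ((show S from s) • o.φ p) y = C.u ((show S from s) • o.φ p) y'
      rw [C.u_left, C.u_left, hy]
    | ha a b h1 h2 => rw [map_add, map_add, AddMonoidHom.add_apply, AddMonoidHom.add_apply, h1, h2]
  have hex : ∀ q, ∃ y, ∀ p, C.u (o.φ p) y = ι (c.u p q) := by
    intro q
    let l := AddEquiv.ofBijective o.lMap h.lMap_bijective
    let H₀ : BTensor R (Res ι S) o.P →+ S :=
      lift R (show Res ι S →+ o.P →+ S from
          (AddMonoidHom.mul (R := S)).compl₂ (ι.toAddMonoidHom.comp (c.u.flip q)))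
        (fun s r p => by
          change ((show S from s) * ι r) * ι (c.u p q) = (show S from s) * ι (c.u (r • p) q)
          rw [c.u_left, map_mul, mul_assoc])
    let H : o.X →+ S := H₀.comp l.symm.toAddMonoidHom
    have Hl : ∀ t, H (l t) = H₀ t := fun t => congrArg H₀ (l.symm_apply_apply t)
    have Hs : ∀ (s : S) x, H (s • x) = s * H x := by
      intro s x
      obtain ⟨t, rfl⟩ := l.surjective x
      have h1 : s • l t = _ := o.lMap_smul s t
      rw [h1]
      change H (l _) = _
      rw [Hl, Hl]
      clear h1
      induction t using BTensor.induction with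
      | hz => simp
      | ht a p => exact mul_assoc s (show S from a) (ι (c.u p q))
      | ha a b h1 h2 => rw [map_add, map_add, map_add, mul_add, h1, h2]
    obtain ⟨s, hs⟩ := C.v_one
    refine ⟨∑ x ∈ s, op (H x.2) • x.1, fun p => ?_⟩
    rw [map_sum]
    have h1 : ∀ x ∈ s, C.u (o.φ p) (op (H x.2) • x.1) = H (op (C.v x.1 x.2) • o.φ p) :=
      fun x _ => by rw [C.u_right, ← Hs, C.u_smul]
    rw [Finset.sum_congr rfl h1, ← map_sum, ← Finset.sum_smul, ← Finset.op_sum, hs, op_one,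
      one_smul]
    have h2 : o.φ p = l (tmul R (M := Res ι S) (1 : S) p) := (one_smul S _).symm
    rw [h2, Hl]
    exact one_mul (ι (c.u p q))
  choose ψ hψ using hex
  let o' : BimodArrow ι :=
    { P := Q
      X := Y
      φ := AddMonoidHom.mk' ψ (fun q q' => hext _ _ fun p => by
        rw [hψ, map_add, map_add, map_add, hψ, hψ])
      map_left := fun r q => hext _ _ fun p => by
        change C.u (o.φ p) (ψ (r • q)) = C.u (o.φ p) (ι r • ψ q)
        rw [hψ, ← C.u_mid, ← o.map_right, hψ, c.u_mid]
      map_right := fun r q => hext _ _ fun p => by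
        change C.u (o.φ p) (ψ (op r • q)) = C.u (o.φ p) (op (ι r) • ψ q)
        rw [hψ, C.u_right, hψ, c.u_right, map_mul] }
  refine ⟨o', ⟨⟨c, C, fun p q => hψ q p, fun q p => ?_⟩⟩⟩
  change C.v (ψ q) (o.φ p) = ι (c.v q p)
  have h1 : ∀ x : o.X, op (C.v (ψ q) (o.φ p)) • x = op (ι (c.v q p)) • x := by
    intro x
    obtain ⟨t, rfl⟩ := h.lMap_bijective.2 x
    induction t using BTensor.induction with
    | hz => simp
    | ht s p' =>
      have h2 : ∀ s : S, op (C.v (ψ q) (o.φ p)) • s • o.φ p' = op (ι (c.v q p)) • s • o.φ p' := by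
        intro s
        rw [← smul_comm s, ← smul_comm s, ← C.u_smul, hψ, ← o.map_left, ← o.map_right, c.u_smul]
      exact h2 s
    | ha a b h1 h2 => rw [map_add, smul_add, smul_add, h1, h2]
  obtain ⟨s, hs⟩ := C.v_one
  rw [← one_mul (C.v (ψ q) (o.φ p)), ← one_mul (ι (c.v q p)), ← hs, Finset.sum_mul,
    Finset.sum_mul]
  exact Finset.sum_congr rfl fun x _ => by rw [← C.v_right, ← C.v_right, h1]

end BimodArrow

end Dual

section RelPic

variable {R : Type u} {S : Type v} [Ring R] [Ring S]

/-- Isomorphism of objects of `M(S/R)`. -/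
instance BimodArrow.setoid (ι : R →+* S) : Setoid {o : BimodArrow ι // o.IsPicard} where
  r a b := Nonempty (a.1.Iso b.1)
  iseqv := ⟨fun a => ⟨.refl a.1⟩, fun ⟨i⟩ => ⟨i.symm⟩, fun ⟨i⟩ ⟨j⟩ => ⟨i.trans j⟩⟩

/-- Miyashita's group `P(S/R)`: the isomorphism classes of objects `φ : P → X` of `M(S/R)`
with `P` and `X` invertible. -/
def RelPic (ι : R →+* S) : Type (max (u + 1) (v + 1)) :=
  Quotient (BimodArrow.setoid ι)

namespace RelPic

open BimodArrow

variable {ι : R →+* S}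

/-- The class of an object. -/
def mk (o : BimodArrow ι) (h : o.IsPicard) : RelPic ι := Quotient.mk _ ⟨o, h⟩

theorem mk_eq_mk {o o' : BimodArrow ι} {h : o.IsPicard} {h' : o'.IsPicard} :
    mk o h = mk o' h' ↔ Nonempty (o.Iso o') := Quotient.eq

theorem ind {p : RelPic ι → Prop} (h : ∀ o ho, p (mk o ho)) (x : RelPic ι) : p x :=
  Quotient.ind (fun a => h a.1 a.2) x

instance : Mul (RelPic ι) where
  mul := Quotient.map₂ (fun a b => ⟨a.1.tensor b.1, a.2.tensor b.2⟩)
    (fun _ _ ⟨i⟩ _ _ ⟨j⟩ => ⟨i.tensor j⟩)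

instance : One (RelPic ι) where
  one := mk (unit ι) isPicard_unit

theorem mk_mul_mk {a b : BimodArrow ι} (ha : a.IsPicard) (hb : b.IsPicard) :
    mk a ha * mk b hb = mk (a.tensor b) (ha.tensor hb) := rfl

theorem one_def : (1 : RelPic ι) = mk (unit ι) isPicard_unit := rfl

theorem exists_inv (x : RelPic ι) : ∃ y, y * x = 1 := by
  induction x using ind with
  | h o ho =>
    obtain ⟨o', ⟨d⟩⟩ := ho.exists_dual
    exact ⟨mk o' d.swap.isPicard, mk_eq_mk.2 ⟨d.swap.iso⟩⟩

noncomputable instance : Inv (RelPic ι) where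
  inv x := (exists_inv x).choose

noncomputable instance : Group (RelPic ι) :=
  Group.ofLeftAxioms
    (by
      intro a b c
      induction a using ind with
      | h a ha => induction b using ind with
        | h b hb => induction c using ind with
          | h c hc => exact mk_eq_mk.2 ⟨tensorAssoc a b c⟩)
    (by
      intro a
      induction a using ind with
      | h a ha => exact mk_eq_mk.2 ⟨unitTensor a⟩)
    (fun x => (exists_inv x).choose_spec)

theorem inv_mk {o o' : BimodArrow ι} (d : Dual o o') :
    (mk o d.isPicard)⁻¹ = mk o' d.swap.isPicard :=
  inv_eq_of_mul_eq_one_right (mk_eq_mk.2 ⟨d.iso⟩)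

end RelPic

/-- The `R`-subbimodules of `S`. -/
structure SubBimodule (ι : R →+* S) extends AddSubgroup S where
  left_mem : ∀ (r : R) {s}, s ∈ carrier → ι r * s ∈ carrier
  right_mem : ∀ (r : R) {s}, s ∈ carrier → s * ι r ∈ carrier

namespace BimodArrow

variable {ι : R →+* S}

/-- The left and right actions of `k` on `P` agree. -/
def IsCentral (k : Type*) [CommRing k] [Algebra k R] (o : BimodArrow ι) : Prop :=
  ∀ (c : k) (p : o.P), algebraMap k R c • p = op (algebraMap k R c) • p

/-- The additive subgroup `N φ(P)` of `X`. -/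
def leftProd (N : SubBimodule ι) (o : BimodArrow ι) : AddSubgroup o.X :=
  AddSubgroup.closure {x | ∃ s ∈ N.toAddSubgroup, ∃ p, x = s • o.φ p}

/-- The additive subgroup `φ(P) N` of `X`. -/
def rightProd (N : SubBimodule ι) (o : BimodArrow ι) : AddSubgroup o.X :=
  AddSubgroup.closure {x | ∃ s ∈ N.toAddSubgroup, ∃ p, x = op s • o.φ p}

theorem smul_mem_leftProd {N : SubBimodule ι} (o : BimodArrow ι) {s : S}
    (hs : s ∈ N.toAddSubgroup) (p : o.P) : s • o.φ p ∈ leftProd N o :=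
  AddSubgroup.subset_closure ⟨s, hs, p, rfl⟩

theorem smul_mem_rightProd {N : SubBimodule ι} (o : BimodArrow ι) {s : S}
    (hs : s ∈ N.toAddSubgroup) (p : o.P) : op s • o.φ p ∈ rightProd N o :=
  AddSubgroup.subset_closure ⟨s, hs, p, rfl⟩

/-- `N φ(P) = φ(P) N`. -/
def Normalizes (N : SubBimodule ι) (o : BimodArrow ι) : Prop := leftProd N o = rightProd N o

theorem normalizes_iff {N : SubBimodule ι} {o : BimodArrow ι} :
    Normalizes N o ↔ (∀ s ∈ N.toAddSubgroup, ∀ p, s • o.φ p ∈ rightProd N o) ∧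
      (∀ s ∈ N.toAddSubgroup, ∀ p, op s • o.φ p ∈ leftProd N o) := by
  refine ⟨fun h => ⟨fun s hs p => ?_, fun s hs p => ?_⟩, fun h => le_antisymm ?_ ?_⟩
  · rw [← h]; exact smul_mem_leftProd o hs p
  · rw [h]; exact smul_mem_rightProd o hs p
  · rw [leftProd, AddSubgroup.closure_le]
    rintro _ ⟨s, hs, p, rfl⟩
    exact h.1 s hs p
  · rw [rightProd, AddSubgroup.closure_le]
    rintro _ ⟨s, hs, p, rfl⟩
    exact h.2 s hs p

theorem normalizes_unit (N : SubBimodule ι) : Normalizes N (unit ι) := by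
  refine normalizes_iff.2 ⟨fun s hs (r : R) => ?_, fun s hs (r : R) => ?_⟩
  · have h := smul_mem_rightProd (N := N) (unit ι) (s := s * ι r) (N.right_mem r hs) (1 : R)
    have h' : op (s * ι r) • (unit ι).φ (1 : R) = s • (unit ι).φ r := by
      change ι 1 * (s * ι r) = s * ι r
      rw [map_one, one_mul]
    rwa [h'] at h
  · have h := smul_mem_leftProd (N := N) (unit ι) (s := ι r * s) (N.left_mem r hs) (1 : R)
    have h' : (ι r * s) • (unit ι).φ (1 : R) = op s • (unit ι).φ r := by
      change ι r * s * ι 1 = ι r * s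
      rw [map_one, mul_one]
    rwa [h'] at h

theorem Normalizes.tensor {N : SubBimodule ι} {a b : BimodArrow ι} (ha : Normalizes N a)
    (hb : Normalizes N b) : Normalizes N (a.tensor b) := by
  rw [normalizes_iff] at ha hb ⊢
  refine ⟨fun s hs t => ?_, fun s hs t => ?_⟩
  · induction t using BTensor.induction with
    | hz => rw [map_zero, smul_zero]; exact zero_mem _
    | ht p q =>
      change BTensor.tmul S (s • a.φ p) (b.φ q) ∈ _
      have h1 : ∀ x ∈ rightProd N a, BTensor.tmul S x (b.φ q) ∈ rightProd N (a.tensor b) := by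
        intro x hx
        induction hx using AddSubgroup.closure_induction with
        | mem x hx =>
          obtain ⟨s', hs', p', rfl⟩ := hx
          rw [BTensor.smul_tmul]
          have h2 : ∀ y ∈ rightProd N b, BTensor.tmul S (a.φ p') y ∈ rightProd N (a.tensor b) := by
            intro y hy
            induction hy using AddSubgroup.closure_induction with
            | mem y hy =>
              obtain ⟨s'', hs'', q', rfl⟩ := hy
              exact smul_mem_rightProd (a.tensor b) hs'' (BTensor.tmul R p' q')
            | zero => rw [BTensor.tmul_zero]; exact zero_mem _
            | add y z _ _ hy hz => rw [BTensor.tmul_add]; exact add_mem hy hz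
            | neg y _ hy =>
              have := (BTensor.mkHom S (a.φ p')).map_neg y
              rw [BTensor.mkHom_apply, BTensor.mkHom_apply] at this
              rw [this]; exact neg_mem hy
          exact h2 _ (hb.1 s' hs' q)
        | zero => rw [BTensor.zero_tmul]; exact zero_mem _
        | add y z _ _ hy hz => rw [BTensor.add_tmul]; exact add_mem hy hz
        | neg y _ hy =>
          have := ((BTensor.mkHom S).flip (b.φ q)).map_neg y
          change BTensor.tmul S (-y) (b.φ q) = - BTensor.tmul S y (b.φ q) at this
          rw [this]; exact neg_mem hy
      exact h1 _ (ha.1 s hs p)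
    | ha x y hx hy => rw [map_add, smul_add]; exact add_mem hx hy
  · induction t using BTensor.induction with
    | hz => rw [map_zero, smul_zero]; exact zero_mem _
    | ht p q =>
      change BTensor.tmul S (a.φ p) (op s • b.φ q) ∈ _
      have h1 : ∀ y ∈ leftProd N b, BTensor.tmul S (a.φ p) y ∈ leftProd N (a.tensor b) := by
        intro y hy
        induction hy using AddSubgroup.closure_induction with
        | mem y hy =>
          obtain ⟨s', hs', q', rfl⟩ := hy
          rw [← BTensor.smul_tmul]
          have h2 : ∀ x ∈ leftProd N a, BTensor.tmul S x (b.φ q') ∈ leftProd N (a.tensor b) := by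
            intro x hx
            induction hx using AddSubgroup.closure_induction with
            | mem x hx =>
              obtain ⟨s'', hs'', p', rfl⟩ := hx
              exact smul_mem_leftProd (a.tensor b) hs'' (BTensor.tmul R p' q')
            | zero => rw [BTensor.zero_tmul]; exact zero_mem _
            | add y z _ _ hy hz => rw [BTensor.add_tmul]; exact add_mem hy hz
            | neg y _ hy =>
              have := ((BTensor.mkHom S).flip (b.φ q')).map_neg y
              change BTensor.tmul S (-y) (b.φ q') = - BTensor.tmul S y (b.φ q') at this
              rw [this]; exact neg_mem hy
          exact h2 _ (ha.2 s' hs' p)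
        | zero => rw [BTensor.tmul_zero]; exact zero_mem _
        | add y z _ _ hy hz => rw [BTensor.tmul_add]; exact add_mem hy hz
        | neg y _ hy =>
          have := (BTensor.mkHom S (a.φ p)).map_neg y
          rw [BTensor.mkHom_apply, BTensor.mkHom_apply] at this
          rw [this]; exact neg_mem hy
      exact h1 _ (hb.2 s hs q)
    | ha x y hx hy => rw [map_add, smul_add]; exact add_mem hx hy

theorem Normalizes.dual {N : SubBimodule ι} {o o' : BimodArrow ι} (d : Dual o o')
    (h : Normalizes N o) : Normalizes N o' := by
  have hr := h.symm.le
  have hl := h.le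
  have hu : ∀ x ∈ leftProd N o, ∀ q, d.C.u x (o'.φ q) ∈ N.toAddSubgroup := by
    intro x hx q
    induction hx using AddSubgroup.closure_induction with
    | mem x hx =>
      obtain ⟨s, hs, p, rfl⟩ := hx
      rw [d.C.u_left, d.hu]
      exact N.right_mem _ hs
    | zero => rw [map_zero]; exact zero_mem _
    | add y z _ _ hy hz => rw [map_add]; exact add_mem hy hz
    | neg y _ hy => rw [map_neg]; exact neg_mem hy
  have hv : ∀ x ∈ rightProd N o, ∀ q, d.C.v (o'.φ q) x ∈ N.toAddSubgroup := by
    intro x hx q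
    induction hx using AddSubgroup.closure_induction with
    | mem x hx =>
      obtain ⟨s, hs, p, rfl⟩ := hx
      rw [d.C.v_right, d.hv]
      exact N.left_mem _ hs
    | zero => rw [map_zero]; exact zero_mem _
    | add y z _ _ hy hz => rw [map_add]; exact add_mem hy hz
    | neg y _ hy => rw [map_neg]; exact neg_mem hy
  refine normalizes_iff.2 ⟨fun s hs q => ?_, fun s hs q => ?_⟩
  · obtain ⟨f, hf⟩ := d.c.v_one
    have h1 : s • o'.φ q =
        ∑ x ∈ f, op (d.C.u (op s • o.φ x.2) (o'.φ q)) • o'.φ x.1 := by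
      have h2 : ∀ x ∈ f, op (d.C.u (op s • o.φ x.2) (o'.φ q)) • o'.φ x.1 =
          ι (d.c.v x.1 x.2) • s • o'.φ q := fun x _ => by
        rw [← d.C.v_smul, d.C.v_right, d.hv, mul_smul]
      rw [Finset.sum_congr rfl h2, ← Finset.sum_smul, ← map_sum, hf, map_one, one_smul]
    rw [h1]
    exact sum_mem fun x _ => smul_mem_rightProd o' (hu _ (hr (smul_mem_rightProd o hs _)) _) _
  · obtain ⟨f, hf⟩ := d.c.u_one
    have h1 : op s • o'.φ q =
        ∑ x ∈ f, d.C.v (o'.φ q) (s • o.φ x.1) • o'.φ x.2 := by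
      have h2 : ∀ x ∈ f, d.C.v (o'.φ q) (s • o.φ x.1) • o'.φ x.2 =
          op (ι (d.c.u x.1 x.2)) • op s • o'.φ q := fun x _ => by
        rw [d.C.v_smul, d.C.u_left, d.hu, op_mul, mul_smul]
      rw [Finset.sum_congr rfl h2, ← Finset.sum_smul, ← Finset.op_sum, ← map_sum, hf, map_one,
        op_one, one_smul]
    rw [h1]
    exact sum_mem fun x _ => smul_mem_leftProd o' (hv _ (hl (smul_mem_leftProd o hs _)) _) _

theorem IsCentral.tensor {k : Type*} [CommRing k] [Algebra k R] {a b : BimodArrow ι}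
    (ha : IsCentral k a) (hb : IsCentral k b) : IsCentral k (a.tensor b) := by
  intro c t
  induction t using BTensor.induction with
  | hz => simp
  | ht p q =>
    change BTensor.tmul R (algebraMap k R c • p) q = BTensor.tmul R p (op (algebraMap k R c) • q)
    rw [ha, BTensor.smul_tmul, hb]
  | ha x y hx hy => rw [smul_add, smul_add, hx, hy]

theorem IsCentral.dual {k : Type*} [CommRing k] [Algebra k R] {o o' : BimodArrow ι}
    (d : Dual o o') (h : IsCentral k o) : IsCentral k o' := fun c q =>
  d.c.ext_right fun p => by
    rw [d.c.u_right, ← d.c.u_mid, ← h, d.c.u_left, Algebra.commutes]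

end BimodArrow

/-- The subgroup `P_k(S/R)^{(G)}` of `P(S/R)`: the classes of the `φ : P → X` such that `P` is
central over `k` and `Γ_g φ(P) = φ(P) Γ_g` for all `g`. -/
def relPicSubgroup {ι : R →+* S} (k : Type*) [CommRing k] [Algebra k R] {G : Type*}
    (Γ : G → SubBimodule ι) : Subgroup (RelPic ι) where
  carrier := {x | ∃ (o : BimodArrow ι) (h : o.IsPicard), x = RelPic.mk o h ∧ o.IsCentral k ∧
    ∀ g, o.leftProd (Γ g) = o.rightProd (Γ g)}
  mul_mem' := by
    rintro _ _ ⟨a, ha, rfl, ca, na⟩ ⟨b, hb, rfl, cb, nb⟩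
    exact ⟨_, ha.tensor hb, rfl, ca.tensor cb, fun g =>
      BimodArrow.Normalizes.tensor (na g) (nb g)⟩
  one_mem' := ⟨_, _, rfl, fun c (r : R) => Algebra.commutes c r,
    fun g => BimodArrow.normalizes_unit (Γ g)⟩
  inv_mem' := by
    rintro _ ⟨a, ha, rfl, ca, na⟩
    obtain ⟨b, ⟨d⟩⟩ := ha.exists_dual
    exact ⟨b, d.swap.isPicard, RelPic.inv_mk d, ca.dual d, fun g =>
      BimodArrow.Normalizes.dual d (na g)⟩

end RelPic

/-! ### The homomorphism from the Picard group of the base -/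

section Induced

variable {k : Type u} {R : Type u} {S : Type (max u v)} [CommRing k] [CommRing R] [Ring S]
  [Algebra k R] [Algebra k S]

/-- The left action `s (p ⊗ t) = p ⊗ s t` of a `k`-algebra `A` on `P ⊗_k A`. -/
noncomputable abbrev leftTensorModule (A : Type*) [Ring A] [Algebra k A] (P : Type*)
    [AddCommGroup P] [Module k P] : Module A (P ⊗[k] A) :=
  (TensorProduct.comm k P A).toAddEquiv.module A

/-- The right action `(p ⊗ t) s = p ⊗ t s` of a `k`-algebra `A` on `P ⊗_k A`. -/
noncomputable abbrev rightTensorModule (A : Type*) [Ring A] [Algebra k A] (P : Type*)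
    [AddCommGroup P] [Module k P] : Module Aᵐᵒᵖ (P ⊗[k] A) :=
  (TensorProduct.comm k P A).toAddEquiv.module Aᵐᵒᵖ

theorem leftTensorModule_smul_tmul {A : Type*} [Ring A] [Algebra k A] {P : Type*}
    [AddCommGroup P] [Module k P] (s t : A) (p : P) :
    (leftTensorModule (k := k) A P).toSMul.smul s (p ⊗ₜ[k] t) = p ⊗ₜ[k] (s * t) := rfl

theorem rightTensorModule_smul_tmul {A : Type*} [Ring A] [Algebra k A] {P : Type*}
    [AddCommGroup P] [Module k P] (s t : A) (p : P) :
    (rightTensorModule (k := k) A P).toSMul.smul (op s) (p ⊗ₜ[k] t) = p ⊗ₜ[k] (t * s) := rfl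

theorem tensor_smulCommClass (A : Type*) [Ring A] [Algebra k A] (P : Type*)
    [AddCommGroup P] [Module k P] :
    @SMulCommClass A Aᵐᵒᵖ (P ⊗[k] A) (leftTensorModule A P).toSMul
      (rightTensorModule A P).toSMul :=
  letI := leftTensorModule (k := k) A P
  letI := rightTensorModule (k := k) A P
  ⟨fun a b t => by
    induction t using TensorProduct.induction_on with
    | zero => rw [smul_zero, smul_zero, smul_zero]
    | tmul p t => exact congrArg (p ⊗ₜ[k] ·) (mul_assoc a t b.unop).symm
    | add x y hx hy => rw [smul_add, smul_add, smul_add, smul_add, hx, hy]⟩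

/-- The object `P₀ ⊗_k R → P₀ ⊗_k S`, `p ⊗ r ↦ p ⊗ ι(r)`, where `s₁ (p ⊗ s) s₂ = p ⊗ s₁ s s₂`. -/
noncomputable def induced (ι : R →ₐ[k] S) (P₀ : Type u) [AddCommGroup P₀] [Module k P₀] :
    BimodArrow (ι : R →+* S) :=
  letI := leftTensorModule (k := k) R P₀
  letI := rightTensorModule (k := k) R P₀
  letI := leftTensorModule (k := k) S P₀
  letI := rightTensorModule (k := k) S P₀
  { P := P₀ ⊗[k] R
    X := P₀ ⊗[k] S
    φ := (LinearMap.lTensor P₀ ι.toLinearMap).toAddMonoidHom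
    leftP := leftTensorModule R P₀
    rightP := rightTensorModule R P₀
    leftX := leftTensorModule S P₀
    rightX := rightTensorModule S P₀
    commP := tensor_smulCommClass R P₀
    commX := tensor_smulCommClass S P₀
    map_left := fun r t => by
      induction t using TensorProduct.induction_on with
      | zero => rw [smul_zero, map_zero, smul_zero]
      | tmul p t => exact congrArg (p ⊗ₜ[k] ·) (map_mul ι r t)
      | add x y hx hy => rw [smul_add, map_add, map_add, smul_add, hx, hy]
    map_right := fun r t => by
      induction t using TensorProduct.induction_on with
      | zero => rw [smul_zero, map_zero, smul_zero]
      | tmul p t => exact congrArg (p ⊗ₜ[k] ·) (map_mul ι t r)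
      | add x y hx hy => rw [smul_add, map_add, map_add, smul_add, hx, hy] }

end Induced

/-! ### Unital partial actions and partial skew group rings -/

/-- A unital partial action of a group `G` on a commutative ring `R`: ideals `D_g`, generated by
idempotents `1_g`, and ring isomorphisms `α_g : D_{g⁻¹} → D_g` such that `D_1 = R`, `α_1 = id`,
`α_h⁻¹(D_h ∩ D_{g⁻¹}) ⊆ D_{(gh)⁻¹}`, and `α_g (α_h x) = α_{gh} x` on `α_h⁻¹(D_h ∩ D_{g⁻¹})`. -/
structure UnitalPartialAction (G : Type v) [Group G] (R : Type u) [CommRing R] where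
  D : G → Ideal R
  e : G → R
  e_idem : ∀ g, IsIdempotentElem (e g)
  D_eq : ∀ g, D g = Ideal.span {e g}
  α : ∀ g, D g⁻¹ ≃+* D g
  D_one : D 1 = ⊤
  α_one : ∀ x : D 1⁻¹, (α 1 x : R) = x
  mem_mul : ∀ (g h : G) (x : D h⁻¹), (α h x : R) ∈ D g⁻¹ → (x : R) ∈ D (g * h)⁻¹
  α_mul : ∀ (g h : G) (x : D h⁻¹) (hx : (α h x : R) ∈ D g⁻¹),
    (α g ⟨α h x, hx⟩ : R) = α (g * h) ⟨x, mem_mul g h x hx⟩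

namespace UnitalPartialAction

variable {G : Type v} [Group G] {R : Type u} [CommRing R] (a : UnitalPartialAction G R)

theorem mem_D {g : G} {x : R} : x ∈ a.D g ↔ x * a.e g = x := by
  rw [a.D_eq, Ideal.mem_span_singleton']
  constructor
  · rintro ⟨y, rfl⟩
    rw [mul_assoc, (a.e_idem g).eq]
  · exact fun h => ⟨x, h⟩

theorem mul_e_mem (g : G) (r : R) : r * a.e g ∈ a.D g := by
  rw [mem_D, mul_assoc, (a.e_idem g).eq]

/-- The map `r ↦ α_g(r 1_{g⁻¹})` on all of `R`. -/
def act (g : G) (r : R) : R := a.α g ⟨r * a.e g⁻¹, a.mul_e_mem g⁻¹ r⟩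

theorem act_mem (g : G) (r : R) : a.act g r ∈ a.D g := (a.α g _).2

theorem act_mul_e (g : G) (r : R) : a.act g r * a.e g = a.act g r := a.mem_D.1 (a.act_mem g r)

theorem act_eq {g : G} {x : R} (hx : x ∈ a.D g⁻¹) : a.act g x = a.α g ⟨x, hx⟩ := by
  unfold act
  congr 2
  exact Subtype.ext (a.mem_D.1 hx)

theorem act_add (g : G) (r s : R) : a.act g (r + s) = a.act g r + a.act g s := by
  unfold act
  rw [← AddMemClass.coe_add, ← map_add]
  congr 2
  exact Subtype.ext (add_mul r s _)

theorem act_mul (g : G) (r s : R) : a.act g (r * s) = a.act g r * a.act g s := by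
  unfold act
  rw [← MulMemClass.coe_mul, ← map_mul]
  congr 2
  refine Subtype.ext ?_
  change r * s * a.e g⁻¹ = r * a.e g⁻¹ * (s * a.e g⁻¹)
  rw [mul_mul_mul_comm, (a.e_idem g⁻¹).eq]

/-- `act` as an additive map. -/
def actHom (g : G) : R →+ R := AddMonoidHom.mk' (a.act g) (a.act_add g)

theorem act_zero (g : G) : a.act g 0 = 0 := map_zero (a.actHom g)

theorem e_one : a.e 1 = 1 := by
  have h : (1 : R) ∈ a.D 1 := by rw [a.D_one]; trivial
  simpa using a.mem_D.1 h

theorem act_one (r : R) : a.act 1 r = r := by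
  unfold act
  rw [a.α_one]
  change r * a.e 1⁻¹ = r
  rw [inv_one, e_one, mul_one]

theorem act_act_of_mem {g h : G} {x : R} (hx : x ∈ a.D h⁻¹) (hy : a.act h x ∈ a.D g⁻¹) :
    a.act g (a.act h x) = a.act (g * h) x := by
  have h1 := a.act_eq hx
  have hy' : (a.α h ⟨x, hx⟩ : R) ∈ a.D g⁻¹ := h1 ▸ hy
  rw [a.act_eq hy, a.act_eq (a.mem_mul g h ⟨x, hx⟩ hy'), ← a.α_mul g h ⟨x, hx⟩ hy']
  congr 2
  exact Subtype.ext h1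

theorem act_inv_act {g : G} {x : R} (hx : x ∈ a.D g⁻¹) : a.act g⁻¹ (a.act g x) = x := by
  rw [a.act_act_of_mem hx (by rw [inv_inv]; exact a.act_mem g x), inv_mul_cancel, act_one]

theorem act_e (g h : G) : a.act g (a.e h) = a.e g * a.e (g * h) := by
  have key : ∀ (g h : G) (x : R), x ∈ a.D g⁻¹ → x ∈ a.D h → a.act g x ∈ a.D (g * h) := by
    intro g h x hx hx'
    have hy : a.act g x ∈ a.D g⁻¹⁻¹ := by rw [inv_inv]; exact a.act_mem g x
    have h1 := a.mem_mul h⁻¹ g⁻¹ ⟨_, hy⟩ (by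
      rw [← a.act_eq hy, a.act_inv_act hx, inv_inv]; exact hx')
    rwa [← mul_inv_rev, inv_inv] at h1
  have hz : a.act g (a.e h) = a.act g (a.e g⁻¹ * a.e h) := by
    unfold act
    congr 2
    refine Subtype.ext ?_
    change a.e h * a.e g⁻¹ = a.e g⁻¹ * a.e h * a.e g⁻¹
    rw [mul_right_comm, (a.e_idem g⁻¹).eq, mul_comm]
  have hm : a.e g⁻¹ * a.e h ∈ a.D g⁻¹ := by rw [mul_comm]; exact a.mul_e_mem _ _
  have hm' : a.e g⁻¹ * a.e h ∈ a.D h := a.mul_e_mem _ _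
  have h1 := a.mem_D.1 (key g h _ hm hm')
  have hw : a.e g * a.e (g * h) ∈ a.D g⁻¹⁻¹ := by
    rw [inv_inv, mul_comm]; exact a.mul_e_mem _ _
  have hw' : a.e g * a.e (g * h) ∈ a.D (g * h) := a.mul_e_mem _ _
  have h2 := key g⁻¹ (g * h) _ hw hw'
  rw [inv_mul_cancel_left] at h2
  have h3 := a.mem_D.1 h2
  have h4 := a.mem_D.1 (a.act_mem g⁻¹ (a.e g * a.e (g * h)))
  have h5 := a.act_inv_act hw
  rw [inv_inv] at h5
  have h6 : a.e g * a.e (g * h) = a.e g * a.e (g * h) * a.act g (a.e g⁻¹ * a.e h) := by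
    have h7 : a.act g⁻¹ (a.e g * a.e (g * h)) =
        a.act g⁻¹ (a.e g * a.e (g * h)) * (a.e g⁻¹ * a.e h) := by
      rw [← mul_assoc, h4, h3]
    have h8 := congrArg (a.act g) h7
    rwa [h5, a.act_mul g (a.act g⁻¹ _), h5] at h8
  rw [hz, h6, mul_right_comm, mul_comm (a.e g), act_mul_e, h1]

theorem act_mul_e_mul (g h : G) {x : R} (hx : x ∈ a.D h) :
    a.act g x * a.e (g * h) = a.act g x := by
  rw [← a.mem_D.1 hx, act_mul, act_e, mul_assoc, mul_assoc, (a.e_idem _).eq]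

theorem act_act (g h : G) (r : R) : a.act g (a.act h r) = a.e g * a.act (g * h) r := by
  have hc : a.act h (a.e (h⁻¹ * g⁻¹)) = a.e h * a.e g⁻¹ := by
    rw [act_e, mul_inv_cancel_left]
  have h1 : a.act g (a.act h r) = a.act g (a.act h (r * a.e (h⁻¹ * g⁻¹) * a.e h⁻¹)) := by
    have : a.act h (r * a.e (h⁻¹ * g⁻¹) * a.e h⁻¹) = a.act h r * a.e g⁻¹ := by
      rw [act_mul, act_mul, hc, act_e, mul_inv_cancel, e_one, mul_one, mul_assoc, mul_right_comm,
        (a.e_idem h).eq, ← mul_assoc, act_mul_e]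
    rw [this, act_mul, act_e, mul_inv_cancel, e_one, mul_one, act_mul_e]
  rw [h1, a.act_act_of_mem (a.mul_e_mem _ _), act_mul, act_mul, act_e, act_e]
  · rw [← mul_inv_rev, mul_inv_cancel, e_one, mul_one, mul_inv_cancel_right, act_mul_e,
      mul_comm (a.e (g * h)), ← mul_assoc, mul_right_comm, act_mul_e, mul_comm]
  · rw [act_mul, act_mul, hc, act_e, mul_inv_cancel, e_one, mul_one, mem_D]
    have := (a.e_idem g⁻¹).eq
    calc _ = a.act h r * a.e h * a.e h * (a.e g⁻¹ * a.e g⁻¹) := by ring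
      _ = _ := by rw [this]; ring

/-- The ring `R^α` of invariants: all `r` with `α_g(r 1_{g⁻¹}) = r 1_g` for every `g`. -/
def invariants : Subring R where
  carrier := {r | ∀ g, a.act g r = r * a.e g}
  mul_mem' := by
    intro r s hr hs g
    rw [act_mul, hr, hs, mul_mul_mul_comm, (a.e_idem g).eq]
  one_mem' := fun g => by
    have h := a.act_e g 1
    rw [e_one, mul_one, (a.e_idem g).eq] at h
    rw [h, one_mul]
  add_mem' := by
    intro r s hr hs g
    rw [act_add, hr, hs, add_mul]
  zero_mem' := fun g => by rw [act_zero, zero_mul]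
  neg_mem' := by
    intro r hr g
    have h : a.act g (-r) = -a.act g r := map_neg (a.actHom g) r
    rw [h, hr, neg_mul]

open Classical in
/-- `R` is an `α`-partial Galois extension of `R^α`. -/
def IsPartialGalois : Prop :=
  ∃ (m : ℕ) (x y : Fin m → R), ∀ g, ∑ i, x i * a.act g (y i) = if g = 1 then 1 else 0

/-- The homogeneous component `D_g δ_g` of the partial skew group ring. -/
def Comp (g : Additive G) : Type u := a.D g.toMul

instance (g : Additive G) : AddCommGroup (a.Comp g) := inferInstanceAs (AddCommGroup (a.D g.toMul))

/-- The underlying element of `R`. -/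
def val {g : Additive G} (x : a.Comp g) : R := Subtype.val (p := (· ∈ a.D g.toMul)) x

theorem val_mem {g : Additive G} (x : a.Comp g) : a.val x ∈ a.D g.toMul :=
  Subtype.property (p := (· ∈ a.D g.toMul)) x

/-- The element `r δ_g`. -/
def mkComp (g : Additive G) (r : R) (h : r ∈ a.D g.toMul) : a.Comp g := ⟨r, h⟩

theorem comp_ext {g : Additive G} {x y : a.Comp g} (h : a.val x = a.val y) : x = y :=
  Subtype.ext h

theorem graded_ext {x y : GradedMonoid a.Comp} (h : x.1 = y.1) (h' : a.val x.2 = a.val y.2) :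
    x = y := by
  obtain ⟨g, x⟩ := x
  obtain ⟨g', y⟩ := y
  obtain rfl : g = g' := h
  obtain rfl : x = y := a.comp_ext h'
  rfl

theorem comp_mul_mem {g h : Additive G} (x : a.Comp g) (y : a.Comp h) :
    a.val x * a.act g.toMul (a.val y) ∈ a.D (g + h).toMul := by
  rw [mem_D, mul_assoc]
  congr 1
  exact a.act_mul_e_mul g.toMul h.toMul (a.val_mem y)

/-- The multiplication `(r δ_g)(s δ_h) = r α_g(s 1_{g⁻¹}) δ_{gh}`. -/
instance : GradedMonoid.GMul a.Comp where
  mul {g h} x y := a.mkComp (g + h) (a.val x * a.act g.toMul (a.val y)) (a.comp_mul_mem x y)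

/-- The identity `1 δ_1`. -/
instance : GradedMonoid.GOne a.Comp where
  one := a.mkComp 0 1 (by change (1 : R) ∈ a.D 1; rw [a.D_one]; trivial)

instance : GradedMonoid.GMonoid a.Comp where
  one_mul x := a.graded_ext (zero_add _) (by
    change 1 * a.act 1 (a.val x.2) = a.val x.2
    rw [one_mul, act_one])
  mul_one x := a.graded_ext (add_zero _) (by
    change a.val x.2 * a.act x.1.toMul 1 = a.val x.2
    have h := a.act_e x.1.toMul 1
    rw [e_one, mul_one, (a.e_idem _).eq] at h
    rw [h]
    exact a.mem_D.1 (a.val_mem x.2))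
  mul_assoc x y z := a.graded_ext (add_assoc _ _ _) (by
    have key : ∀ (g h : G) (p q r : R), p * a.act g q * a.act (g * h) r =
        p * a.act g (q * a.act h r) := by
      intro g h p q r
      rw [act_mul, act_act, ← mul_assoc (a.act g q), act_mul_e, mul_assoc]
    exact key x.1.toMul y.1.toMul (a.val x.2) (a.val y.2) (a.val z.2))

instance : DirectSum.GRing a.Comp where
  mul_zero x := a.comp_ext ((congrArg (a.val x * ·) (a.act_zero _)).trans (mul_zero _))
  zero_mul x := a.comp_ext (zero_mul _)
  mul_add x y z := a.comp_ext
    ((congrArg (a.val x * ·) (a.act_add _ (a.val y) (a.val z))).trans (mul_add _ _ _))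
  add_mul x y z := a.comp_ext (add_mul _ _ _)
  natCast n := a.mkComp 0 n (by change (n : R) ∈ a.D 1; rw [a.D_one]; trivial)
  natCast_zero := a.comp_ext Nat.cast_zero
  natCast_succ n := a.comp_ext (Nat.cast_succ n)
  intCast n := a.mkComp 0 n (by change (n : R) ∈ a.D 1; rw [a.D_one]; trivial)
  intCast_ofNat n := a.comp_ext (Int.cast_natCast n)
  intCast_negSucc_ofNat n := a.comp_ext (Int.cast_negSucc n)

/-- The partial skew group ring `R ⋆_α G = ⨁ D_g δ_g`. -/
def SkewGroupRing : Type (max u v) := DirectSum (Additive G) a.Comp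

open Classical in
noncomputable instance : Ring a.SkewGroupRing :=
  inferInstanceAs (Ring (DirectSum (Additive G) a.Comp))

open Classical in
/-- The map `D_g → R ⋆_α G`, `r ↦ r δ_g`. -/
noncomputable def single (g : G) : a.D g →+ a.SkewGroupRing :=
  DirectSum.of a.Comp (Additive.ofMul g)

theorem single_congr {g h : G} (hgh : g = h) {x y : R} (hx : x ∈ a.D g) (hy : y ∈ a.D h)
    (hxy : x = y) : a.single g ⟨x, hx⟩ = a.single h ⟨y, hy⟩ := by
  subst hgh hxy; rfl

theorem mul_act_mem {g h : G} (x : a.D g) (y : a.D h) :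
    (x : R) * a.act g y ∈ a.D (g * h) :=
  a.comp_mul_mem (g := Additive.ofMul g) (h := Additive.ofMul h) x y

theorem single_mul_single {g h : G} (x : a.D g) (y : a.D h) :
    a.single g x * a.single h y = a.single (g * h) ⟨x * a.act g y, a.mul_act_mem x y⟩ := by
  classical
  exact DirectSum.of_mul_of (A := a.Comp) (i := Additive.ofMul g) (j := Additive.ofMul h) x y

theorem mem_D_one (r : R) : r ∈ a.D 1 := by rw [a.D_one]; trivial

/-- The embedding `R → R ⋆_α G`, `r ↦ r δ_1`. -/
noncomputable def incl : R →+* a.SkewGroupRing where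
  toFun r := a.single 1 ⟨r, a.mem_D_one r⟩
  map_one' := rfl
  map_mul' r s := by
    rw [single_mul_single]
    exact a.single_congr (mul_one 1).symm _ _ (by rw [act_one])
  map_zero' := map_zero (a.single 1)
  map_add' r s := map_add (a.single 1) ⟨r, _⟩ ⟨s, _⟩

theorem incl_mul_single {g : G} (r : R) (x : a.D g) :
    a.incl r * a.single g x = a.single g (r • x) := by
  refine (a.single_mul_single (g := 1) ⟨r, a.mem_D_one r⟩ x).trans ?_
  exact a.single_congr (one_mul g) _ (r • x).2 (by rw [act_one]; rfl)

theorem single_mul_incl {g : G} (r : R) (x : a.D g) :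
    a.single g x * a.incl r = a.single g (a.act g r • x) := by
  refine (a.single_mul_single (h := 1) x ⟨r, a.mem_D_one r⟩).trans ?_
  exact a.single_congr (mul_one g) _ (a.act g r • x).2 (mul_comm _ _)

theorem skew_induction {p : a.SkewGroupRing → Prop} (s : a.SkewGroupRing) (hz : p 0)
    (hs : ∀ g x, p (a.single g x)) (ha : ∀ s t, p s → p t → p (s + t)) : p s := by
  classical
  exact DirectSum.induction_on (β := a.Comp) (motive := p) s hz (fun i x => hs i.toMul x) ha

/-- `R ⋆_α G` is an algebra over `R^α`. -/
noncomputable instance : Algebra a.invariants a.SkewGroupRing :=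
  (a.incl.comp a.invariants.subtype).toAlgebra' (fun c s => by
    induction s using a.skew_induction with
    | hz => rw [mul_zero, zero_mul]
    | hs g x =>
      change a.incl (c : R) * _ = _ * a.incl (c : R)
      rw [incl_mul_single, single_mul_incl, c.2 g]
      congr 1
      refine Subtype.ext ?_
      change (c : R) * x = c * a.e g * x
      rw [mul_assoc, mul_comm (a.e g), a.mem_D.1 x.2]
    | ha s t h1 h2 => rw [mul_add, add_mul, h1, h2])

/-- The embedding `R → R ⋆_α G` as a map of `R^α`-algebras. -/
noncomputable def inclAlg : R →ₐ[a.invariants] a.SkewGroupRing where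
  __ := a.incl
  commutes' _ := rfl

/-- The partial representation `Θ₀(g) = D_g δ_g` of `G` in the `R`-subbimodules of `R ⋆_α G`. -/
noncomputable def theta (g : G) :
    SubBimodule (a.inclAlg : R →+* a.SkewGroupRing) where
  __ := (a.single g).range
  left_mem r := by
    rintro _ ⟨x, rfl⟩
    exact ⟨r • x, (a.incl_mul_single r x).symm⟩
  right_mem r := by
    rintro _ ⟨x, rfl⟩
    exact ⟨a.act g r • x, (a.single_mul_incl r x).symm⟩

end UnitalPartialAction

end RelPicard

/-!
Write `k = R^α` and `S = R ⋆_α G`. Base change `P₀ ↦ (P₀ ⊗_k R → P₀ ⊗_k S)` takes tensor products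
over `k` to products of objects (`RelPicard.inducedTensor`), so it gives a homomorphism from
the Picard group of `k` (`RelPicard.UnitalPartialAction.picHom`). That it is bijective is Galois
descent.

An object `φ : P → X` contains the `k`-module `P₀` of all `p` such that `φ(p)` commutes with `S`
(`RelPicard.commutant`). If `P` is central over `R` and `φ(P)` is normalized by all `D_g δ_g`, the
rule `1_g δ_g φ(p) = φ(β_g(p)) 1_g δ_g` defines a partial action `β` of `G` on `P` that is
semilinear over `α` (`RelPicard.UnitalPartialAction.exists_partial_action`), and `P₀` consists of
its invariants. With Galois coordinates `x_i, y_i`, the map `p ↦ ∑ tr(y_i p) ⊗ x_i`, where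
`tr = ∑ β_g`, is inverse to the multiplication `P₀ ⊗_k R → P`
(`RelPicard.UnitalPartialAction.commutantMul_bijective`), so the object is induced from `P₀`
(`RelPicard.nonempty_iso_induced_commutant`).

It remains to see that `P₀` is invertible, and that `P₀` is free of rank one if its induced object
is trivial. In both cases there is a `k`-linear map to `k`, from `P₀ ⊗ Q₀` for the dual object
`Q → Y`, respectively from `P₀` itself, with values in `k` because the central elements of `S` that
lie in `R` are the elements of `k`. The ideal of its values generates the unit ideal of `R`. As the
traces make `R` finite over `k`, the ideal is all of `k`, and surjectivity of the map implies
bijectivity (`RelPicard.invertible_commutant`, `RelPicard.nonempty_linearEquiv_of_iso_unit`).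
-/

namespace RelPicard

open MulOpposite

open scoped TensorProduct

-- The bimodule structure on `P ⊗_k A` that `induced` uses: `A` acts on both sides through the
-- second factor.
attribute [local instance] leftTensorModule rightTensorModule tensor_smulCommClass

/-! ### Base change to a `k`-algebra as a bimodule -/

section BaseChange

variable {k : Type*} [CommRing k] {A : Type*} [Ring A] [Algebra k A]
  {P : Type*} [AddCommGroup P] [Module k P]

theorem smul_tmul_eq (s t : A) (p : P) : s • (p ⊗ₜ[k] t) = p ⊗ₜ[k] (s * t) := rfl

theorem op_smul_tmul_eq (s t : A) (p : P) : op s • (p ⊗ₜ[k] t) = p ⊗ₜ[k] (t * s) := rfl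

theorem algebraMap_smul_tensor (c : k) (t : P ⊗[k] A) : algebraMap k A c • t = c • t := by
  induction t using TensorProduct.induction_on with
  | zero => rw [smul_zero, smul_zero]
  | tmul p t => rw [smul_tmul_eq, ← Algebra.smul_def, TensorProduct.tmul_smul]
  | add x y hx hy => rw [smul_add, smul_add, hx, hy]

section Left

variable (k A P) (N : Type*) [AddCommGroup N] [Module k N] [Module A N] [IsScalarTower k A N]

/-- The map underlying `cancelLeft`. -/
noncomputable def cancelLeftHom : BTensor A (P ⊗[k] A) N →+ P ⊗[k] N :=
  BTensor.lift A
    (AddMonoidHom.flip (AddMonoidHom.mk'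
      (fun n => (((LinearMap.toSpanSingleton A N n).restrictScalars k).lTensor P).toAddMonoidHom)
      (fun m n => by
        ext t
        induction t using TensorProduct.induction_on with
        | zero => simp only [map_zero]
        | tmul p a =>
          change p ⊗ₜ[k] (a • (m + n)) = p ⊗ₜ[k] (a • m) + p ⊗ₜ[k] (a • n)
          rw [smul_add, TensorProduct.tmul_add]
        | add x y hx hy => rw [map_add, map_add, hx, hy])))
    (fun t r n => by
      induction t using TensorProduct.induction_on with
      | zero => simp only [smul_zero, map_zero, AddMonoidHom.zero_apply]
      | tmul p a => exact congrArg (p ⊗ₜ[k] ·) (mul_smul a r n)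
      | add x y hx hy =>
        simp only [smul_add, map_add, AddMonoidHom.add_apply, hx, hy])

/-- The map `p ⊗ n ↦ (p ⊗ 1) ⊗ n`, inverse to `cancelLeftHom`. -/
noncomputable def cancelLeftInv : P ⊗[k] N →+ BTensor A (P ⊗[k] A) N :=
  TensorProduct.liftAddHom
    ((BTensor.mkHom A (M := P ⊗[k] A) (N := N)).comp
      (((TensorProduct.mk k P A).flip 1).toAddMonoidHom))
    (fun c p n => by
      change BTensor.tmul A ((c • p) ⊗ₜ[k] (1 : A)) n = BTensor.tmul A (p ⊗ₜ[k] (1 : A)) (c • n)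
      rw [← algebraMap_smul A c n, ← BTensor.smul_tmul, op_smul_tmul_eq, one_mul,
        Algebra.algebraMap_eq_smul_one, TensorProduct.smul_tmul])

/-- `(P ⊗_k A) ⊗_A N ≃ P ⊗_k N`, `(p ⊗ a) ⊗ n ↦ p ⊗ a n`. -/
noncomputable def cancelLeft : BTensor A (P ⊗[k] A) N ≃+ P ⊗[k] N :=
  AddMonoidHom.toAddEquiv (cancelLeftHom k A P N) (cancelLeftInv k A P N)
    (BTensor.hom_ext fun t n => by
      induction t using TensorProduct.induction_on with
      | zero => simp only [BTensor.zero_tmul, map_zero]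
      | tmul p a =>
        change BTensor.tmul A (p ⊗ₜ[k] (1 : A)) (a • n) = BTensor.tmul A (p ⊗ₜ[k] a) n
        rw [← BTensor.smul_tmul, op_smul_tmul_eq, one_mul]
      | add x y hx hy => rw [BTensor.add_tmul, map_add, map_add, hx, hy])
    (AddMonoidHom.ext fun t => by
      induction t using TensorProduct.induction_on with
      | zero => simp only [map_zero]
      | tmul p n =>
        change p ⊗ₜ[k] ((1 : A) • n) = p ⊗ₜ[k] n
        rw [one_smul]
      | add x y hx hy => rw [map_add, map_add, hx, hy])

end Left

section Right

variable (k A P) (N : Type*) [AddCommGroup N] [Module k N] [Module Aᵐᵒᵖ N]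
  [IsScalarTower k Aᵐᵒᵖ N]

/-- The map underlying `cancelRight`. -/
noncomputable def cancelRightHom : BTensor A N (P ⊗[k] A) →+ P ⊗[k] N :=
  BTensor.lift A
    (AddMonoidHom.mk'
      (fun n => (((LinearMap.toSpanSingleton Aᵐᵒᵖ N n).restrictScalars k ∘ₗ
        (opLinearEquiv k (M := A)).toLinearMap).lTensor P).toAddMonoidHom)
      (fun m n => by
        ext t
        induction t using TensorProduct.induction_on with
        | zero => simp only [map_zero]
        | tmul p a =>
          change p ⊗ₜ[k] (op a • (m + n)) = p ⊗ₜ[k] (op a • m) + p ⊗ₜ[k] (op a • n)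
          rw [smul_add, TensorProduct.tmul_add]
        | add x y hx hy => rw [map_add, map_add, hx, hy]))
    (fun n r t => by
      induction t using TensorProduct.induction_on with
      | zero => simp only [smul_zero, map_zero]
      | tmul p a =>
        change p ⊗ₜ[k] (op a • op r • n) = p ⊗ₜ[k] (op (r * a) • n)
        rw [op_mul, mul_smul]
      | add x y hx hy => simp only [smul_add, map_add, hx, hy])

/-- The map `p ⊗ n ↦ n ⊗ (p ⊗ 1)`, inverse to `cancelRightHom`. -/
noncomputable def cancelRightInv : P ⊗[k] N →+ BTensor A N (P ⊗[k] A) :=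
  TensorProduct.liftAddHom
    ((BTensor.mkHom A (M := N) (N := P ⊗[k] A)).flip.comp
      (((TensorProduct.mk k P A).flip 1).toAddMonoidHom))
    (fun c p n => by
      change BTensor.tmul A n ((c • p) ⊗ₜ[k] (1 : A)) = BTensor.tmul A (c • n) (p ⊗ₜ[k] (1 : A))
      rw [← algebraMap_smul Aᵐᵒᵖ c n]
      change _ = BTensor.tmul A (op (algebraMap k A c) • n) _
      rw [BTensor.smul_tmul, smul_tmul_eq, mul_one,
        Algebra.algebraMap_eq_smul_one, TensorProduct.smul_tmul])

/-- `N ⊗_A (P ⊗_k A) ≃ P ⊗_k N`, `n ⊗ (p ⊗ a) ↦ p ⊗ n a`. -/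
noncomputable def cancelRight : BTensor A N (P ⊗[k] A) ≃+ P ⊗[k] N :=
  AddMonoidHom.toAddEquiv (cancelRightHom k A P N) (cancelRightInv k A P N)
    (BTensor.hom_ext fun n t => by
      induction t using TensorProduct.induction_on with
      | zero => simp only [BTensor.tmul_zero, map_zero]
      | tmul p a =>
        change BTensor.tmul A (op a • n) (p ⊗ₜ[k] (1 : A)) = BTensor.tmul A n (p ⊗ₜ[k] a)
        rw [BTensor.smul_tmul, smul_tmul_eq, mul_one]
      | add x y hx hy => rw [BTensor.tmul_add, map_add, map_add, hx, hy])
    (AddMonoidHom.ext fun t => by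
      induction t using TensorProduct.induction_on with
      | zero => simp only [map_zero]
      | tmul p n =>
        change p ⊗ₜ[k] (op (1 : A) • n) = p ⊗ₜ[k] n
        rw [op_one, one_smul]
      | add x y hx hy => rw [map_add, map_add, hx, hy])

end Right

variable (k A P) in
theorem isScalarTower_tensor : IsScalarTower k A (P ⊗[k] A) :=
  ⟨fun c a t => by rw [Algebra.smul_def, mul_smul, algebraMap_smul_tensor]⟩

variable (A P) in
/-- `(P ⊗_k A) ⊗_A (Q ⊗_k A) ≃ (P ⊗_k Q) ⊗_k A`, `(p ⊗ a) ⊗ (q ⊗ b) ↦ (p ⊗ q) ⊗ a b`, as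
bimodules. -/
noncomputable def tensorBaseChange (Q : Type*) [AddCommGroup Q] [Module k Q] :
    BimodEquiv A (BTensor A (P ⊗[k] A) (Q ⊗[k] A)) ((P ⊗[k] Q) ⊗[k] A) :=
  haveI := isScalarTower_tensor k A Q
  let e : BTensor A (P ⊗[k] A) (Q ⊗[k] A) ≃+ (P ⊗[k] Q) ⊗[k] A :=
    (cancelLeft k A P (Q ⊗[k] A)).trans (TensorProduct.assoc k P Q A).symm.toAddEquiv
  have he : ∀ p a q b, e (BTensor.tmul A (p ⊗ₜ a) (q ⊗ₜ b)) = (p ⊗ₜ q) ⊗ₜ (a * b) :=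
    fun _ _ _ _ => rfl
  { __ := e
    map_left := fun r t => by
      change e _ = r • e _
      induction t using BTensor.induction with
      | hz => simp only [smul_zero, map_zero]
      | ht x y =>
        rw [BTensor.smul_tmul_left]
        induction x using TensorProduct.induction_on with
        | zero => simp only [smul_zero, BTensor.zero_tmul, map_zero]
        | tmul p a =>
          induction y using TensorProduct.induction_on with
          | zero => simp only [smul_zero, BTensor.tmul_zero, map_zero]
          | tmul q b => rw [smul_tmul_eq, he, he, smul_tmul_eq, mul_assoc]
          | add x y hx hy => simp only [BTensor.tmul_add, map_add, smul_add, hx, hy]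
        | add x y hx hy => simp only [BTensor.add_tmul, map_add, smul_add, hx, hy]
      | ha x y hx hy => simp only [map_add, smul_add, hx, hy]
    map_right := fun r t => by
      change e _ = op r • e _
      induction t using BTensor.induction with
      | hz => simp only [smul_zero, map_zero]
      | ht x y =>
        rw [BTensor.smul_tmul_right]
        induction x using TensorProduct.induction_on with
        | zero => simp only [smul_zero, BTensor.zero_tmul, map_zero]
        | tmul p a =>
          induction y using TensorProduct.induction_on with
          | zero => simp only [smul_zero, BTensor.tmul_zero, map_zero]
          | tmul q b => rw [op_smul_tmul_eq, he, he, op_smul_tmul_eq, mul_assoc]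
          | add x y hx hy => simp only [BTensor.tmul_add, map_add, smul_add, hx, hy]
        | add x y hx hy => simp only [BTensor.add_tmul, map_add, smul_add, hx, hy]
      | ha x y hx hy => simp only [map_add, smul_add, hx, hy] }

variable (A) in
/-- The isomorphism of bimodules `e ⊗ A` induced by a `k`-linear isomorphism `e`. -/
noncomputable def baseChangeCongr {Q : Type*} [AddCommGroup Q] [Module k Q] (e : P ≃ₗ[k] Q) :
    BimodEquiv A (P ⊗[k] A) (Q ⊗[k] A) where
  __ := (e.rTensor A).toAddEquiv
  map_left r t := by
    change e.rTensor A _ = r • e.rTensor A _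
    induction t using TensorProduct.induction_on with
    | zero => simp only [smul_zero, map_zero]
    | tmul p a => rfl
    | add x y hx hy => simp only [smul_add, map_add, hx, hy]
  map_right r t := by
    change e.rTensor A _ = op r • e.rTensor A _
    induction t using TensorProduct.induction_on with
    | zero => simp only [smul_zero, map_zero]
    | tmul p a => rfl
    | add x y hx hy => simp only [smul_add, map_add, hx, hy]

variable (k A) in
/-- The isomorphism of bimodules `k ⊗_k A ≃ A`. -/
noncomputable def baseChangeSelf : BimodEquiv A (k ⊗[k] A) A where
  __ := (TensorProduct.lid k A).toAddEquiv
  map_left r t := by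
    change TensorProduct.lid k A _ = r • TensorProduct.lid k A _
    induction t using TensorProduct.induction_on with
    | zero => simp only [smul_zero, map_zero]
    | tmul c a =>
      rw [smul_tmul_eq, TensorProduct.lid_tmul, TensorProduct.lid_tmul, smul_eq_mul,
        mul_smul_comm]
    | add x y hx hy => simp only [smul_add, map_add, hx, hy]
  map_right r t := by
    change TensorProduct.lid k A _ = op r • TensorProduct.lid k A _
    induction t using TensorProduct.induction_on with
    | zero => simp only [smul_zero, map_zero]
    | tmul c a =>
      rw [op_smul_tmul_eq, TensorProduct.lid_tmul, TensorProduct.lid_tmul, op_smul_eq_mul,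
        smul_mul_assoc]
    | add x y hx hy => simp only [smul_add, map_add, hx, hy]

end BaseChange

/-- The base change of an invertible module is an invertible bimodule. -/
theorem isInvertible_baseChange {k : Type u} [CommRing k] {A : Type (max u v)} [Ring A]
    [Algebra k A] (P : Type u) [AddCommGroup P] [Module k P] [Module.Invertible k P] :
    IsInvertible A (P ⊗[k] A) :=
  ⟨Module.Dual k P ⊗[k] A, inferInstance, inferInstance, inferInstance, inferInstance,
    ⟨(tensorBaseChange A P _).trans ((baseChangeCongr A (P := P ⊗[k] Module.Dual k P) (TensorProduct.comm k _ _ ≪≫ₗ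
      Module.Invertible.linearEquiv k P)).trans (baseChangeSelf k A))⟩,
    ⟨(tensorBaseChange A _ P).trans ((baseChangeCongr A (P := Module.Dual k P ⊗[k] P)
      (Module.Invertible.linearEquiv k P)).trans (baseChangeSelf k A))⟩⟩

/-! ### The objects of `M(S/R)` induced from the base ring -/

section InducedPicard

variable {k : Type u} {R : Type u} {S : Type (max u v)} [CommRing k] [CommRing R] [Ring S]
  [Algebra k R] [Algebra k S] (ι : R →ₐ[k] S)

namespace Res

instance moduleBase : Module k (Res (ι : R →+* S) S) := inferInstanceAs (Module k S)

instance isScalarTower_left : IsScalarTower k R (Res (ι : R →+* S) S) :=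
  ⟨fun c r (s : S) => by
    change ι (c • r) * s = c • (ι r * s)
    rw [map_smul, smul_mul_assoc]⟩

instance isScalarTower_right : IsScalarTower k Rᵐᵒᵖ (Res (ι : R →+* S) S) :=
  ⟨fun c r (s : S) => by
    change s * ι (c • r.unop) = c • (s * ι r.unop)
    rw [map_smul, mul_smul_comm]⟩

end Res

variable (P₀ : Type u) [AddCommGroup P₀] [Module k P₀]

/-- The element `p ⊗ r` of `P₀ ⊗_k R`, as an element of the source of `induced ι P₀`. -/
noncomputable def inducedTmul {P₀ : Type u} [AddCommGroup P₀] [Module k P₀] (p : P₀) (r : R) :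
    (induced ι P₀).P :=
  p ⊗ₜ[k] r

variable {P₀} in
@[elab_as_elim]
theorem induced_induction {motive : (induced ι P₀).P → Prop} (t : (induced ι P₀).P)
    (zero : motive 0) (tmul : ∀ p r, motive (inducedTmul ι p r))
    (add : ∀ x y, motive x → motive y → motive (x + y)) : motive t :=
  TensorProduct.induction_on (motive := motive) t zero tmul add

theorem induced_rMap_bijective : Function.Bijective (induced ι P₀).rMap := by
  let e : BTensor R (induced ι P₀).P (Res (ι : R →+* S) S) ≃+ (induced ι P₀).X :=
    cancelLeft k R P₀ (Res (ι : R →+* S) S)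
  have h : (induced ι P₀).rMap = e.toAddMonoidHom := BTensor.hom_ext fun t s => by
    induction t using induced_induction with
    | zero => rw [BTensor.zero_tmul, map_zero, map_zero]
    | tmul p r => rfl
    | add x y hx hy => rw [BTensor.add_tmul, map_add, map_add, hx, hy]
  rw [h]
  exact e.bijective

theorem induced_lMap_bijective : Function.Bijective (induced ι P₀).lMap := by
  let e : BTensor R (Res (ι : R →+* S) S) (induced ι P₀).P ≃+ (induced ι P₀).X :=
    cancelRight k R P₀ (Res (ι : R →+* S) S)
  have h : (induced ι P₀).lMap = e.toAddMonoidHom := BTensor.hom_ext fun s t => by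
    induction t using induced_induction with
    | zero => rw [BTensor.tmul_zero, map_zero, map_zero]
    | tmul p r => rfl
    | add x y hx hy => rw [BTensor.tmul_add, map_add, map_add, hx, hy]
  rw [h]
  exact e.bijective

theorem induced_isPicard [Module.Invertible k P₀] : (induced ι P₀).IsPicard where
  rMap_bijective := induced_rMap_bijective ι P₀
  lMap_bijective := induced_lMap_bijective ι P₀
  invertible_P := isInvertible_baseChange.{u, u} (A := R) P₀
  invertible_X := isInvertible_baseChange.{u, v} (A := S) P₀

theorem induced_isCentral : (induced ι P₀).IsCentral R := fun c t => by
  change c • t = op c • t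
  induction t using induced_induction with
  | zero => rw [smul_zero, smul_zero]
  | tmul p r => exact congrArg (p ⊗ₜ[k] ·) (mul_comm c r)
  | add x y hx hy => rw [smul_add, smul_add, hx, hy]

/-- Both sides consist of the sums of the elements `p ⊗ s` with `s` in the subbimodule. -/
theorem induced_normalizes (N : SubBimodule (ι : R →+* S)) :
    (induced ι P₀).leftProd N = (induced ι P₀).rightProd N := by
  refine BimodArrow.normalizes_iff.2 ⟨fun s hs t => ?_, fun s hs t => ?_⟩
  · induction t using induced_induction with
    | zero => rw [map_zero, smul_zero]; exact zero_mem _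
    | tmul p r =>
      have h := BimodArrow.smul_mem_rightProd (induced ι P₀) (N.right_mem r hs) (inducedTmul ι p 1)
      have h' : op (s * ι r) • (induced ι P₀).φ (inducedTmul ι p 1) =
          s • (induced ι P₀).φ (inducedTmul ι p r) := by
        change p ⊗ₜ[k] (ι 1 * (s * ι r)) = p ⊗ₜ[k] (s * ι r)
        rw [map_one, one_mul]
      exact h' ▸ h
    | add x y hx hy => rw [map_add, smul_add]; exact add_mem hx hy
  · induction t using induced_induction with
    | zero => rw [map_zero, smul_zero]; exact zero_mem _
    | tmul p r =>
      have h := BimodArrow.smul_mem_leftProd (induced ι P₀) (N.left_mem r hs) (inducedTmul ι p 1)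
      have h' : (ι r * s) • (induced ι P₀).φ (inducedTmul ι p 1) =
          op s • (induced ι P₀).φ (inducedTmul ι p r) := by
        change p ⊗ₜ[k] (ι r * s * ι 1) = p ⊗ₜ[k] (ι r * s)
        rw [map_one, mul_one]
      exact h' ▸ h
    | add x y hx hy => rw [map_add, smul_add]; exact add_mem hx hy

variable {P₀} in
/-- Isomorphic modules induce isomorphic objects. -/
noncomputable def inducedCongr {Q₀ : Type u} [AddCommGroup Q₀] [Module k Q₀] (e : P₀ ≃ₗ[k] Q₀) :
    (induced ι P₀).Iso (induced ι Q₀) where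
  e := baseChangeCongr R e
  f := baseChangeCongr S e
  comm t := by
    induction t using induced_induction with
    | zero => rw [map_zero, map_zero, map_zero, map_zero]
    | tmul p r => rfl
    | add x y hx hy => rw [map_add, map_add, map_add, map_add, hx, hy]

/-- Base change takes tensor products to products of objects. -/
noncomputable def inducedTensor (Q₀ : Type u) [AddCommGroup Q₀] [Module k Q₀] :
    ((induced ι P₀).tensor (induced ι Q₀)).Iso (induced ι (P₀ ⊗[k] Q₀)) where
  e := tensorBaseChange R P₀ Q₀
  f := tensorBaseChange S P₀ Q₀
  comm t := by
    induction t using BTensor.induction with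
    | hz => simp only [map_zero]
    | ht x y =>
      induction x using induced_induction with
      | zero => rw [BTensor.zero_tmul, map_zero, map_zero, map_zero, map_zero]
      | tmul p r =>
        induction y using induced_induction with
        | zero => rw [BTensor.tmul_zero, map_zero, map_zero, map_zero, map_zero]
        | tmul q s => exact (congrArg ((p ⊗ₜ[k] q) ⊗ₜ[k] ·) (map_mul ι r s)).symm
        | add x y hx hy => rw [BTensor.tmul_add, map_add, map_add, map_add, map_add, hx, hy]
      | add x y hx hy => rw [BTensor.add_tmul, map_add, map_add, map_add, map_add, hx, hy]
    | ha x y hx hy => simp only [map_add, hx, hy]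

end InducedPicard

/-! ### Descent along the centralized elements of an object -/

section Commutant

variable {k : Type u} {R : Type u} {S : Type (max u v)} [CommRing k] [CommRing R] [Ring S]
  [Algebra k R] [Algebra k S] {ι : R →ₐ[k] S}

/-- The elements `p` of `P` with `s φ(p) = φ(p) s` for all `s` in `S`. -/
def commutant (o : BimodArrow (ι : R →+* S)) : AddSubgroup o.P where
  carrier := {p | ∀ s : S, s • o.φ p = op s • o.φ p}
  zero_mem' s := by rw [map_zero, smul_zero, smul_zero]
  add_mem' {p q} hp hq s := by rw [map_add, smul_add, smul_add, hp s, hq s]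
  neg_mem' {p} hp s := by rw [map_neg, smul_neg, smul_neg, hp s]

theorem algebraMap_smul_mem_commutant {o : BimodArrow (ι : R →+* S)} (c : k) {p : o.P}
    (hp : p ∈ commutant o) : algebraMap k R c • p ∈ commutant o := fun s => by
  have h : (ι : R →+* S) (algebraMap k R c) = algebraMap k S c := ι.commutes c
  rw [o.map_left, h, ← mul_smul, ← Algebra.commutes c s, mul_smul, hp s, smul_comm]

/-- The centralized elements form a module over `k`, as the image of `k` is central in `S`. -/
instance commutantModule (o : BimodArrow (ι : R →+* S)) : Module k (commutant o) where
  smul c p := ⟨algebraMap k R c • (p : o.P), algebraMap_smul_mem_commutant c p.2⟩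
  one_smul p := Subtype.ext <| by
    change algebraMap k R 1 • (p : o.P) = p
    rw [map_one, one_smul]
  mul_smul c d p := Subtype.ext <| by
    change algebraMap k R (c * d) • (p : o.P) = algebraMap k R c • algebraMap k R d • (p : o.P)
    rw [map_mul, mul_smul]
  smul_zero c := Subtype.ext <| smul_zero (algebraMap k R c)
  smul_add c p q := Subtype.ext <| smul_add (algebraMap k R c) (p : o.P) q
  add_smul c d p := Subtype.ext <| by
    change algebraMap k R (c + d) • (p : o.P) = algebraMap k R c • (p : o.P) +
      algebraMap k R d • (p : o.P)
    rw [map_add, add_smul]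
  zero_smul p := Subtype.ext <| by
    change algebraMap k R 0 • (p : o.P) = 0
    rw [map_zero, zero_smul]

theorem commutant_coe_smul {o : BimodArrow (ι : R →+* S)} (c : k) (p : commutant o) :
    ((c • p : commutant o) : o.P) = algebraMap k R c • (p : o.P) := rfl

/-- The map `p ⊗ r ↦ r p` from the base change of the centralized elements to `P`. -/
def commutantMul (o : BimodArrow (ι : R →+* S)) : commutant o ⊗[k] R →+ o.P :=
  TensorProduct.liftAddHom ((smulAddHom R o.P).flip.comp (commutant o).subtype)
    (fun c p r => by
      change r • algebraMap k R c • (p : o.P) = (c • r) • (p : o.P)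
      rw [← mul_smul, Algebra.smul_def, mul_comm])

theorem commutantMul_tmul {o : BimodArrow (ι : R →+* S)} (p : commutant o) (r : R) :
    commutantMul o (p ⊗ₜ[k] r) = r • (p : o.P) := rfl

/-- The map `p ⊗ s ↦ φ(p) s` from the base change of the centralized elements to `X`. -/
def commutantMulX (o : BimodArrow (ι : R →+* S)) : commutant o ⊗[k] S →+ o.X :=
  TensorProduct.liftAddHom
    (((smulAddHom Sᵐᵒᵖ o.X).comp (opAddEquiv (α := S)).toAddMonoidHom).flip.comp
      (o.φ.comp (commutant o).subtype))
    (fun c p s => by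
      change op s • o.φ (algebraMap k R c • (p : o.P)) = op (c • s) • o.φ p
      have h : (ι : R →+* S) (algebraMap k R c) = algebraMap k S c := ι.commutes c
      rw [o.map_left, h, p.2, ← mul_smul, ← op_mul, Algebra.smul_def])

/-- If the centralized elements generate `P` freely over `R`, then the object is induced from the
`k`-module which they form. -/
theorem nonempty_iso_induced_commutant {o : BimodArrow (ι : R →+* S)} (hc : o.IsCentral R)
    (hr : Function.Bijective o.rMap) (hm : Function.Bijective (commutantMul o)) :
    Nonempty ((induced ι (commutant o)).Iso o) := by
  let e₀ : (induced ι (commutant o)).P →+ o.P := commutantMul o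
  let f₀ : (induced ι (commutant o)).X →+ o.X := commutantMulX o
  let e : BimodEquiv R (induced ι (commutant o)).P o.P := .ofBijective e₀
    (fun r t => by
      induction t using induced_induction with
      | zero => rw [smul_zero, map_zero, smul_zero]
      | tmul p r' => exact mul_smul r r' (p : o.P)
      | add x y hx hy => rw [smul_add, map_add, map_add, smul_add, hx, hy])
    (fun r t => by
      induction t using induced_induction with
      | zero => rw [smul_zero, map_zero, smul_zero]
      | tmul p r' =>
        change (r' * r) • (p : o.P) = op r • r' • (p : o.P)
        rw [mul_smul, ← smul_comm r' (op r)]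
        exact congrArg (r' • ·) (hc r p)
      | add x y hx hy => rw [smul_add, map_add, map_add, smul_add, hx, hy]) hm
  have hcomm : ∀ t, f₀ ((induced ι (commutant o)).φ t) = o.φ (e₀ t) := fun t => by
    induction t using induced_induction with
    | zero => rw [map_zero, map_zero, map_zero, map_zero]
    | tmul p r =>
      change op ((ι : R →+* S) r) • o.φ p = o.φ (r • (p : o.P))
      rw [o.map_left, p.2]
    | add x y hx hy => rw [map_add, map_add, map_add, map_add, hx, hy]
  have hfr : ∀ (s : S) t, f₀ (op s • t) = op s • f₀ t := fun s t => by
    refine TensorProduct.induction_on (motive := fun t => f₀ (op s • t) = op s • f₀ t) t ?_ ?_ ?_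
    · exact (congrArg f₀ (smul_zero (op s))).trans
        ((map_zero f₀).trans ((smul_zero (op s)).symm.trans (congrArg _ (map_zero f₀).symm)))
    · intro p s'
      change op (s' * s) • o.φ p = op s • op s' • o.φ p
      rw [op_mul, mul_smul]
    · intro x y hx hy
      exact (congrArg f₀ (smul_add (op s) x y)).trans <| (map_add f₀ _ _).trans <|
        (congrArg₂ (· + ·) hx hy).trans <| (smul_add (op s) _ _).symm.trans
          (congrArg _ (map_add f₀ x y).symm)
  have hfl : ∀ (s : S) t, f₀ (s • t) = s • f₀ t := fun s t => by
    refine TensorProduct.induction_on (motive := fun t => f₀ (s • t) = s • f₀ t) t ?_ ?_ ?_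
    · exact (congrArg f₀ (smul_zero s)).trans
        ((map_zero f₀).trans ((smul_zero s).symm.trans (congrArg _ (map_zero f₀).symm)))
    · intro p s'
      change op (s * s') • o.φ p = s • op s' • o.φ p
      rw [op_mul, mul_smul, ← p.2, ← smul_comm s]
    · intro x y hx hy
      exact (congrArg f₀ (smul_add s x y)).trans <| (map_add f₀ _ _).trans <|
        (congrArg₂ (· + ·) hx hy).trans <| (smul_add s _ _).symm.trans
          (congrArg _ (map_add f₀ x y).symm)
  -- `f₀` becomes `e ⊗ S : (P₀ ⊗_k R) ⊗_R S → P ⊗_R S` along the isomorphisms `rMap`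
  have hf : Function.Bijective f₀ := by
    let c := BTensor.congrAdd R (N := Res (ι : R →+* S) S) e.toAddEquiv (AddEquiv.refl _) e.right
      (fun _ _ => rfl)
    have h1 : o.rMap.comp c.toAddMonoidHom = f₀.comp (induced ι (commutant o)).rMap :=
      BTensor.hom_ext fun t (s : S) => by
        change op s • o.φ (e₀ t) = f₀ (op s • (induced ι (commutant o)).φ t)
        rw [hfr, hcomm]
    have h2 : (o.rMap ∘ c : _ → _) = f₀ ∘ (induced ι (commutant o)).rMap :=
      congrArg DFunLike.coe h1
    rw [← (induced_rMap_bijective ι (commutant o)).of_comp_iff, ← h2]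
    exact hr.comp c.bijective
  exact ⟨⟨e, .ofBijective f₀ hfl hfr hf, hcomm⟩⟩

/-- By integrality, an ideal of `k` that generates the unit ideal of a finite faithful extension
is the unit ideal. -/
theorem ideal_eq_top_of_one_mem_map [FaithfulSMul k R] [Module.Finite k R] {I : Ideal k}
    (h : (1 : R) ∈ I.map (algebraMap k R)) : I = ⊤ :=
  (Ideal.map_eq_top_iff (algebraMap k R) (FaithfulSMul.algebraMap_injective k R)
    (algebraMap_isIntegral_iff.2 inferInstance)).1 ((Ideal.eq_top_iff_one _).2 h)

/-- The pairing of dual objects restricts to a pairing of the centralized elements with values in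
`k`, provided that `k` contains all elements of `R` that are central in `S`. -/
theorem exists_commutant_pairing [FaithfulSMul k R]
    (hk : ∀ r : R, (∀ s : S, s * ι r = ι r * s) → ∃ c, algebraMap k R c = r)
    {o o' : BimodArrow (ι : R →+* S)} (d : o.Dual o') (hc : o.IsCentral R) :
    ∃ B : commutant o →ₗ[k] commutant o' →ₗ[k] k,
      ∀ p q, algebraMap k R (B p q) = d.c.u p q := by
  have hinj := FaithfulSMul.algebraMap_injective k R
  have h : ∀ (p : commutant o) (q : commutant o'), ∃ c, algebraMap k R c = d.c.u p q := by
    intro p q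
    refine hk _ fun s => ?_
    have h1 : ι (d.c.u p q) = d.C.u (o.φ p) (o'.φ q) := (d.hu p q).symm
    rw [h1, ← d.C.u_left, p.2, d.C.u_mid, q.2, d.C.u_right]
  choose B hB using h
  refine ⟨LinearMap.mk₂ k B ?_ ?_ ?_ ?_, hB⟩
  · intro p p' q
    apply hinj
    rw [map_add, hB, hB, hB, AddSubgroup.coe_add, map_add, AddMonoidHom.add_apply]
  · intro c p q
    apply hinj
    rw [smul_eq_mul, map_mul, hB, hB, commutant_coe_smul, d.c.u_left]
  · intro p q q'
    apply hinj
    rw [map_add, hB, hB, hB, AddSubgroup.coe_add, map_add]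
  · intro c p q
    apply hinj
    have h1 : algebraMap k R c • (p : o.P) = op (algebraMap k R c) • (p : o.P) := hc _ _
    rw [smul_eq_mul, map_mul, hB, hB, commutant_coe_smul, ← d.c.u_mid, ← h1, d.c.u_left]

/-- The centralized elements of two dual objects form dual invertible `k`-modules, if they
generate the objects over `R`. -/
theorem invertible_commutant [FaithfulSMul k R] [Module.Finite k R]
    (hk : ∀ r : R, (∀ s : S, s * ι r = ι r * s) → ∃ c, algebraMap k R c = r)
    {o o' : BimodArrow (ι : R →+* S)} (d : o.Dual o') (hc : o.IsCentral R)
    (hm : Function.Surjective (commutantMul o)) (hm' : Function.Surjective (commutantMul o')) :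
    Module.Invertible k (commutant o) := by
  have hc' : o'.IsCentral R := hc.dual d
  have hinj := FaithfulSMul.algebraMap_injective k R
  obtain ⟨B, hB⟩ := exists_commutant_pairing hk d hc
  obtain ⟨B', hB'⟩ := exists_commutant_pairing hk d.swap hc'
  let E : commutant o ⊗[k] commutant o' →ₗ[k] k := TensorProduct.lift B
  have hE : ∀ p q, E (p ⊗ₜ q) = B p q := fun _ _ => rfl
  have h1 : ∀ p q p', B p q • p' = B' q p' • p := fun p q p' => Subtype.ext <| by
    rw [commutant_coe_smul, commutant_coe_smul, hB, hB', d.c.u_smul]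
    exact (hc _ _).symm
  have h2 : ∀ q p q', B' q p • q' = B p q' • q := fun q p q' => Subtype.ext <| by
    rw [commutant_coe_smul, commutant_coe_smul, hB, hB']
    exact (d.c.v_smul _ _ _).trans (hc' _ _).symm
  -- both sides are `u(p, q) (p' ⊗ q')` on elementary tensors, by the two laws of a Morita context
  have hswap : ∀ w t, E w • t = E t • w := by
    intro w t
    induction w using TensorProduct.induction_on with
    | zero => rw [map_zero, zero_smul, smul_zero]
    | tmul p q =>
      induction t using TensorProduct.induction_on with
      | zero => rw [map_zero, zero_smul, smul_zero]
      | tmul p' q' =>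
        rw [hE, hE, TensorProduct.smul_tmul', h1, TensorProduct.smul_tmul, h2,
          TensorProduct.tmul_smul]
      | add x y hx hy => rw [map_add, smul_add, add_smul, hx, hy]
    | add x y hx hy => rw [map_add, smul_add, add_smul, hx, hy]
  have hrange : LinearMap.range E = ⊤ := by
    have key : ∀ p q, d.c.u p q ∈ Ideal.map (algebraMap k R) (LinearMap.range E) := by
      intro p q
      obtain ⟨t, rfl⟩ := hm p
      obtain ⟨t', rfl⟩ := hm' q
      induction t using TensorProduct.induction_on with
      | zero => rw [map_zero, map_zero]; exact zero_mem _
      | tmul p r =>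
        rw [commutantMul_tmul, d.c.u_left]
        refine Ideal.mul_mem_left _ _ ?_
        induction t' using TensorProduct.induction_on with
        | zero => rw [map_zero, map_zero]; exact zero_mem _
        | tmul q r' =>
          have h3 : r' • (q : o'.P) = op r' • (q : o'.P) := hc' r' q
          rw [commutantMul_tmul, h3, d.c.u_right, ← hB, ← hE]
          exact Ideal.mul_mem_right _ _ (Ideal.mem_map_of_mem _ ⟨_, rfl⟩)
        | add x y hx hy => rw [map_add, map_add]; exact add_mem hx hy
      | add x y hx hy => rw [map_add, map_add]; exact add_mem hx hy
    refine ideal_eq_top_of_one_mem_map (R := R) ?_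
    obtain ⟨s, hs⟩ := d.c.u_one
    rw [← hs]
    exact sum_mem fun x _ => key x.1 x.2
  obtain ⟨t, ht⟩ := LinearMap.range_eq_top.1 hrange 1
  refine Module.Invertible.left (LinearEquiv.ofBijective E
    ⟨(injective_iff_map_eq_zero E).2 fun w hw => ?_, LinearMap.range_eq_top.1 hrange⟩)
  rw [← one_smul k w, ← ht, ← hswap, hw, zero_smul]

/-- A module whose induced object is trivial is free of rank one: the images of the `p ⊗ 1` are
central in `S`, and they generate the unit ideal of `R`. -/
theorem nonempty_linearEquiv_of_iso_unit [FaithfulSMul k R] [Module.Finite k R]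
    (hk : ∀ r : R, (∀ s : S, s * ι r = ι r * s) → ∃ c, algebraMap k R c = r)
    (P₀ : Type u) [AddCommGroup P₀] [Module k P₀] [Module.Invertible k P₀]
    (i : (induced ι P₀).Iso (BimodArrow.unit (ι : R →+* S))) : Nonempty (P₀ ≃ₗ[k] k) := by
  have hinj := FaithfulSMul.algebraMap_injective k R
  have h : ∀ p : P₀, ∃ c, algebraMap k R c = i.e.toAddEquiv (inducedTmul ι p 1) := by
    intro p
    refine hk _ fun s => ?_
    have h1 : ι (i.e.toAddEquiv (inducedTmul ι p 1)) =
        i.f.toAddEquiv ((induced ι P₀).φ (inducedTmul ι p 1)) := (i.comm _).symm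
    have h2 : s • (induced ι P₀).φ (inducedTmul ι p 1) =
        op s • (induced ι P₀).φ (inducedTmul ι p 1) := by
      change p ⊗ₜ[k] (s * ι 1) = p ⊗ₜ[k] (ι 1 * s)
      rw [map_one, mul_one, one_mul]
    rw [h1]
    exact (i.f.left s _).symm.trans ((congrArg i.f.toAddEquiv h2).trans (i.f.right s _))
  choose j hj using h
  let J : P₀ →ₗ[k] k :=
    { toFun := j
      map_add' := fun p q => hinj <| by
        have h1 : inducedTmul ι (p + q) 1 = inducedTmul ι p 1 + inducedTmul ι q 1 :=
          TensorProduct.add_tmul p q (1 : R)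
        rw [map_add, hj, hj, hj, h1, map_add]
      map_smul' := fun c p => hinj <| by
        have h1 : inducedTmul ι (c • p) 1 = algebraMap k R c • inducedTmul ι p 1 := by
          change (c • p) ⊗ₜ[k] (1 : R) = p ⊗ₜ[k] (algebraMap k R c * 1)
          rw [mul_one, Algebra.algebraMap_eq_smul_one, TensorProduct.smul_tmul]
        rw [RingHom.id_apply, smul_eq_mul, map_mul, hj, hj, h1, i.e.left, smul_eq_mul] }
  have key : ∀ t, (show R from i.e.toAddEquiv t) ∈
      Ideal.map (algebraMap k R) (LinearMap.range J) := by
    intro t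
    induction t using induced_induction with
    | zero => rw [map_zero]; exact zero_mem _
    | tmul p r =>
      have h1 : inducedTmul ι p r = r • inducedTmul ι p 1 :=
        congrArg (p ⊗ₜ[k] ·) (mul_one r).symm
      rw [h1, i.e.left, ← hj]
      exact Ideal.mul_mem_left _ _ (Ideal.mem_map_of_mem _ ⟨p, rfl⟩)
    | add x y hx hy => rw [map_add]; exact add_mem hx hy
  have htop : LinearMap.range J = ⊤ := ideal_eq_top_of_one_mem_map (R := R) <| by
    have h1 := key (i.e.toAddEquiv.symm (1 : R))
    rwa [i.e.toAddEquiv.apply_symm_apply] at h1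
  exact ⟨LinearEquiv.ofBijective J
    (Module.Invertible.bijective_of_surjective (LinearMap.range_eq_top.1 htop))⟩

end Commutant

/-! ### The partial skew group ring -/

namespace UnitalPartialAction

variable {G : Type v} [Group G] {R : Type u} [CommRing R] (a : UnitalPartialAction G R)

/-- The coefficient at `δ_g`, as an element of `R`. -/
noncomputable def coeff (g : G) : a.SkewGroupRing →+ R :=
  (Submodule.subtype (a.D g)).toAddMonoidHom.comp
    (show a.SkewGroupRing →+ a.D g from
      DFinsupp.evalAddMonoidHom (β := a.Comp) (Additive.ofMul g))

theorem coeff_single_self (g : G) (x : a.D g) : a.coeff g (a.single g x) = x := by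
  classical
  exact congrArg a.val (DirectSum.of_eq_same (β := a.Comp) (Additive.ofMul g) x)

theorem coeff_single_of_ne {g h : G} (hgh : h ≠ g) (x : a.D h) :
    a.coeff g (a.single h x) = 0 := by
  classical
  exact congrArg a.val (DirectSum.of_eq_of_ne (β := a.Comp) (Additive.ofMul h)
    (Additive.ofMul g) x (Ne.symm hgh))

theorem coeff_incl_mul (g : G) (r : R) (s : a.SkewGroupRing) :
    a.coeff g (a.incl r * s) = r * a.coeff g s := by
  induction s using a.skew_induction with
  | hz => rw [mul_zero, map_zero, mul_zero]
  | hs h x =>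
    rw [incl_mul_single]
    by_cases hgh : h = g
    · subst hgh
      rw [coeff_single_self, coeff_single_self]
      rfl
    · rw [a.coeff_single_of_ne hgh, a.coeff_single_of_ne hgh, mul_zero]
  | ha s t hs ht => rw [mul_add, map_add, map_add, hs, ht, mul_add]

/-- The element `1_g δ_g`. -/
noncomputable def unitSingle (g : G) : a.SkewGroupRing :=
  a.single g ⟨a.e g, a.mem_D.2 (a.e_idem g)⟩

theorem single_eq (g : G) (x : a.D g) : a.single g x = a.incl x * a.unitSingle g := by
  rw [unitSingle, incl_mul_single]
  exact a.single_congr rfl x.2 _ (a.mem_D.1 x.2).symm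

theorem incl_e_mul_unitSingle (g : G) : a.incl (a.e g) * a.unitSingle g = a.unitSingle g := by
  conv_rhs => rw [unitSingle, single_eq]

theorem unitSingle_mul_incl (g : G) (r : R) :
    a.unitSingle g * a.incl r = a.incl (a.act g r) * a.unitSingle g := by
  rw [unitSingle, incl_mul_single, single_mul_incl]

theorem unitSingle_mul_unitSingle (g h : G) :
    a.unitSingle g * a.unitSingle h = a.incl (a.e g) * a.unitSingle (g * h) := by
  rw [unitSingle, unitSingle, unitSingle, incl_mul_single, single_mul_single]
  refine a.single_congr rfl _ (a.e g • _ : a.D (g * h)).2 ?_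
  change a.e g * a.act g (a.e h) = a.e g * a.e (g * h)
  rw [act_e, ← mul_assoc, (a.e_idem g).eq]

theorem unitSingle_one : a.unitSingle 1 = 1 :=
  a.single_congr rfl _ (a.mem_D_one 1) a.e_one

theorem unitSingle_mem_theta (g : G) : a.unitSingle g ∈ (a.theta g).toAddSubgroup := ⟨_, rfl⟩

theorem unitSingle_mul_inv (g : G) :
    a.unitSingle g * a.unitSingle g⁻¹ = a.incl (a.e g) := by
  rw [unitSingle_mul_unitSingle, mul_inv_cancel, unitSingle_one, mul_one]

/-- The elements of `R` that are central in `R ⋆_α G` are the invariants. -/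
theorem exists_algebraMap_eq (r : R) (h : ∀ s, s * a.inclAlg r = a.inclAlg r * s) :
    ∃ c, algebraMap a.invariants R c = r := by
  refine ⟨⟨r, fun g => ?_⟩, rfl⟩
  have h1 : a.unitSingle g * a.incl r = a.incl r * a.unitSingle g := h _
  rw [unitSingle_mul_incl] at h1
  have h2 := congrArg (a.coeff g) h1
  rw [coeff_incl_mul, coeff_incl_mul, unitSingle, coeff_single_self, act_mul_e] at h2
  exact h2

instance faithfulSMul_invariants : FaithfulSMul a.invariants R :=
  (faithfulSMul_iff_algebraMap_injective _ _).2 Subtype.val_injective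

theorem act_sum {ι : Type*} (g : G) (s : Finset ι) (f : ι → R) :
    a.act g (∑ i ∈ s, f i) = ∑ i ∈ s, a.act g (f i) := map_sum (a.actHom g) f s

section Trace

variable [Fintype G]

/-- The trace `∑_g α_g(r 1_{g⁻¹})` of an element of `R`, as an invariant. -/
def trace (r : R) : a.invariants :=
  ⟨∑ g, a.act g r, fun h => by
    rw [act_sum, Finset.sum_congr rfl fun g _ => a.act_act h g r, ← Finset.mul_sum,
      Fintype.sum_equiv (Equiv.mulLeft h) (fun g => a.act (h * g) r) (fun g => a.act g r)
        (fun _ => rfl), mul_comm]⟩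

theorem coe_trace (r : R) : (a.trace r : R) = ∑ g, a.act g r := rfl

/-- The Galois coordinates recover each element from its traces. -/
theorem sum_mul_trace {m : ℕ} {x y : Fin m → R} [DecidableEq G]
    (h : ∀ g, ∑ i, x i * a.act g (y i) = if g = 1 then 1 else 0) (r : R) :
    ∑ i, (a.trace (y i * r) : R) * x i = r := by
  have h1 : ∀ i, (a.trace (y i * r) : R) * x i = ∑ g, x i * a.act g (y i) * a.act g r := by
    intro i
    rw [coe_trace, Finset.sum_mul]
    exact Finset.sum_congr rfl fun g _ => by rw [act_mul]; ring
  rw [Finset.sum_congr rfl fun i _ => h1 i, Finset.sum_comm,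
    Finset.sum_congr rfl fun g _ => (Finset.sum_mul _ _ _).symm]
  simp [h, act_one]

end Trace

theorem IsPartialGalois.finite [Finite G] {a : UnitalPartialAction G R} (h : a.IsPartialGalois) :
    Module.Finite a.invariants R := by
  classical
  have := Fintype.ofFinite G
  obtain ⟨m, x, y, hxy⟩ := h
  refine ⟨⟨Finset.univ.image x, (Submodule.eq_top_iff').2 fun r => ?_⟩⟩
  rw [← a.sum_mul_trace hxy r]
  refine sum_mem fun i _ => ?_
  exact Submodule.smul_mem _ (a.trace (y i * r)) (Submodule.subset_span (by simp))

/-! ### The partial action on a normalizing object -/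

variable {a} {o : BimodArrow (a.inclAlg : R →+* a.SkewGroupRing)}

theorem map_smul_incl (r : R) (p : o.P) : o.φ (r • p) = a.incl r • o.φ p := o.map_left r p

theorem map_op_smul_incl (r : R) (p : o.P) : o.φ (op r • p) = op (a.incl r) • o.φ p :=
  o.map_right r p

/-- `P → P ⊗_R S` is split by the coefficient at the identity. -/
theorem arrow_injective (hr : Function.Bijective o.rMap) : Function.Injective o.φ := by
  let F : BTensor R o.P (Res (a.inclAlg : R →+* a.SkewGroupRing) a.SkewGroupRing) →+ o.P :=
    BTensor.lift R (show o.P →+ Res (a.inclAlg : R →+* a.SkewGroupRing) a.SkewGroupRing →+ o.P from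
      (((smulAddHom Rᵐᵒᵖ o.P).comp (opAddEquiv (α := R)).toAddMonoidHom).comp
        (a.coeff 1)).flip)
      (fun p r (s : a.SkewGroupRing) => by
        change op (a.coeff 1 s) • op r • p = op (a.coeff 1 (a.incl r * s)) • p
        rw [coeff_incl_mul, op_mul, mul_smul])
  have hF : ∀ p, F (BTensor.tmul R (N := Res (a.inclAlg : R →+* a.SkewGroupRing) a.SkewGroupRing)
      p (1 : a.SkewGroupRing)) = p := fun p => by
    change op (a.coeff 1 (a.single 1 ⟨1, a.mem_D_one 1⟩)) • p = p
    rw [coeff_single_self, op_one, one_smul]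
  intro p q hpq
  have h1 : ∀ p, o.φ p = o.rMap (BTensor.tmul R
      (N := Res (a.inclAlg : R →+* a.SkewGroupRing) a.SkewGroupRing) p (1 : a.SkewGroupRing)) :=
    fun p => (one_smul _ (o.φ p)).symm
  rw [h1, h1] at hpq
  rw [← hF p, ← hF q, hr.1 hpq]

/-- If `D_g δ_g φ(P) = φ(P) D_g δ_g` for all `g`, then `1_g δ_g φ(p) = φ(β_g(p)) 1_g δ_g` for
unique elements `β_g(p)` of `1_g P`, and the maps `β_g` form a partial action of `G` on `P`. -/
theorem exists_partial_action (hc : o.IsCentral R) (hr : Function.Bijective o.rMap)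
    (hn : ∀ g, o.leftProd (a.theta g) = o.rightProd (a.theta g)) :
    ∃ β : G → o.P →+ o.P,
      (∀ g p, a.unitSingle g • o.φ p = op (a.unitSingle g) • o.φ (β g p)) ∧
      (∀ g p q, a.unitSingle g • o.φ p = op (a.unitSingle g) • o.φ q → a.e g • q = q →
        q = β g p) ∧
      (∀ g p, a.e g • β g p = β g p) ∧
      (∀ g r p, β g (r • p) = a.act g r • β g p) ∧
      (∀ g h p, β g (β h p) = a.e g • β (g * h) p) ∧ ∀ p, β 1 p = p := by
  have hinj := arrow_injective hr
  have hc' : ∀ (r : R) (p : o.P), op r • p = r • p := fun r p => (hc r p).symm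
  -- right multiplication by `1_g δ_g` is injective on `φ(1_g P)`
  have huniq : ∀ g (p q : o.P), a.e g • p = p → a.e g • q = q →
      op (a.unitSingle g) • o.φ p = op (a.unitSingle g) • o.φ q → p = q := by
    intro g p q hp hq h
    have h1 := congrArg (op (a.unitSingle g⁻¹) • ·) h
    simp only [← mul_smul, ← op_mul, unitSingle_mul_inv, ← map_op_smul_incl, hc', hp, hq] at h1
    exact hinj h1
  have hmem : ∀ g, ∀ x ∈ o.rightProd (a.theta g), ∃ q : o.P, a.e g • q = q ∧
      x = op (a.unitSingle g) • o.φ q := by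
    intro g x hx
    induction hx using AddSubgroup.closure_induction with
    | mem x hx =>
      obtain ⟨_, ⟨r, rfl⟩, p, rfl⟩ := hx
      refine ⟨(r : R) • p, ?_, ?_⟩
      · rw [← mul_smul, mul_comm, a.mem_D.1 r.2]
      · rw [single_eq, op_mul, mul_smul, ← map_op_smul_incl, hc']
    | zero => exact ⟨0, smul_zero _, by rw [map_zero, smul_zero]⟩
    | add x y _ _ hx hy =>
      obtain ⟨p, hp, rfl⟩ := hx
      obtain ⟨q, hq, rfl⟩ := hy
      exact ⟨p + q, by rw [smul_add, hp, hq], by rw [map_add, smul_add]⟩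
    | neg x _ hx =>
      obtain ⟨p, hp, rfl⟩ := hx
      exact ⟨-p, by rw [smul_neg, hp], by rw [map_neg, smul_neg]⟩
  have hex : ∀ g (p : o.P), ∃ q : o.P, a.e g • q = q ∧
      a.unitSingle g • o.φ p = op (a.unitSingle g) • o.φ q := fun g p =>
    hmem g _ (hn g ▸ BimodArrow.smul_mem_leftProd o (a.unitSingle_mem_theta g) p)
  choose β hβe hβ using hex
  have huniq' : ∀ g p q, a.unitSingle g • o.φ p = op (a.unitSingle g) • o.φ q → a.e g • q = q →
      q = β g p := fun g p q h hq => huniq g _ _ hq (hβe g p) (h.symm.trans (hβ g p))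
  have hsmul : ∀ g r p, β g (r • p) = a.act g r • β g p := fun g r p => by
    refine (huniq' g _ _ ?_ ?_).symm
    · rw [map_smul_incl, ← mul_smul, unitSingle_mul_incl, mul_smul, hβ, map_smul_incl, smul_comm]
    · rw [smul_comm, hβe]
  have hmul : ∀ g h p, β g (β h p) = a.e g • β (g * h) p := fun g h p => by
    refine huniq (g * h) _ _ ?_ ?_ ?_
    · conv_rhs => rw [← hβe h p, hsmul, act_e, mul_comm, mul_smul, hβe]
    · rw [smul_comm, hβe]
    · have h1 : (a.unitSingle g * a.unitSingle h) • o.φ p =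
          op (a.unitSingle (g * h)) • o.φ (β g (β h p)) := by
        rw [mul_smul, hβ h, smul_comm, hβ g, ← mul_smul, ← op_mul, unitSingle_mul_unitSingle,
          op_mul, mul_smul, ← map_op_smul_incl, hc', hβe]
      rw [← h1, unitSingle_mul_unitSingle, mul_smul, hβ (g * h), smul_comm, ← map_smul_incl]
  refine ⟨fun g => AddMonoidHom.mk' (β g) fun p q => (huniq' g _ _ ?_ ?_).symm, hβ, huniq', hβe,
    hsmul, hmul, fun p => (huniq' 1 _ _ ?_ ?_).symm⟩
  · rw [map_add, smul_add, hβ, hβ, map_add, smul_add]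
  · rw [smul_add, hβe, hβe]
  · rw [unitSingle_one, op_one, one_smul, one_smul]
  · rw [e_one, one_smul]

/-- Galois descent: `P` is freely generated over `R` by its centralized elements. The inverse of
`p ⊗ r ↦ r p` is `p ↦ ∑ tr(y_i p) ⊗ x_i`, where `tr(p) = ∑ β_g(p)`. -/
theorem commutantMul_bijective [Finite G] (ha : a.IsPartialGalois) (hc : o.IsCentral R)
    (hr : Function.Bijective o.rMap)
    (hn : ∀ g, o.leftProd (a.theta g) = o.rightProd (a.theta g)) :
    Function.Bijective (commutantMul (ι := a.inclAlg) o) := by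
  classical
  have := Fintype.ofFinite G
  obtain ⟨m, x, y, hxy⟩ := ha
  obtain ⟨β, hβ, huniq, hβe, hsmul, hmul, hone⟩ := exists_partial_action hc hr hn
  have hc' : ∀ (r : R) (p : o.P), op r • p = r • p := fun r p => (hc r p).symm
  have hmem : ∀ p : o.P, (∀ g, β g p = a.e g • p) → p ∈ commutant (ι := a.inclAlg) o := by
    intro p hp s
    induction s using a.skew_induction with
    | hz => rw [op_zero, zero_smul, zero_smul]
    | hs g r =>
      have h1 : a.e g * r = r := by rw [mul_comm]; exact a.mem_D.1 r.2
      rw [single_eq, mul_smul, hβ, hp, smul_comm, ← map_smul_incl, ← mul_smul, mul_comm, h1,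
        op_mul, mul_smul, ← map_op_smul_incl, hc']
    | ha s t hs ht => rw [op_add, add_smul, add_smul, hs, ht]
  -- conversely, `s = 1_g δ_g` shows that the centralized elements are invariant under `β`
  have hfix : ∀ (p : commutant (ι := a.inclAlg) o) g, β g p = a.e g • (p : o.P) := by
    intro p g
    refine (huniq g _ _ ?_ ?_).symm
    · rw [map_smul_incl, ← smul_comm, ← p.2, ← mul_smul, incl_e_mul_unitSingle]
    · rw [← mul_smul, (a.e_idem g).eq]
  let tr : o.P →+ commutant (ι := a.inclAlg) o :=
    AddMonoidHom.codRestrict (∑ g, β g) _ fun p => hmem _ fun h => by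
      rw [AddMonoidHom.finsetSum_apply, map_sum, Finset.sum_congr rfl fun g _ => hmul h g p,
        ← Finset.smul_sum]
      exact congrArg _ (Fintype.sum_equiv (Equiv.mulLeft h) _ _ fun _ => rfl)
  have htr : ∀ p, (tr p : o.P) = ∑ g, β g p := fun p => AddMonoidHom.finsetSum_apply _ _ _
  have htr' : ∀ (r : R) (p : commutant (ι := a.inclAlg) o), tr (r • (p : o.P)) = a.trace r • p := by
    intro r p
    refine Subtype.ext ?_
    rw [htr, commutant_coe_smul]
    change _ = (a.trace r : R) • (p : o.P)
    rw [coe_trace, Finset.sum_smul]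
    exact Finset.sum_congr rfl fun g _ => by rw [hsmul, hfix, ← mul_smul, act_mul_e]
  let n : o.P →+ commutant (ι := a.inclAlg) o ⊗[a.invariants] R :=
    ∑ i, ((TensorProduct.mk a.invariants _ R).flip (x i)).toAddMonoidHom.comp
      (tr.comp (DistribSMul.toAddMonoidHom o.P (y i)))
  have hn' : ∀ p, n p = ∑ i, tr (y i • p) ⊗ₜ[a.invariants] x i := fun p =>
    AddMonoidHom.finsetSum_apply _ _ _
  refine (AddMonoidHom.toAddEquiv (commutantMul (ι := a.inclAlg) o) n ?_ ?_).bijective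
  · refine AddMonoidHom.ext fun t => ?_
    change n (commutantMul o t) = t
    induction t using TensorProduct.induction_on with
    | zero => rw [map_zero, map_zero]
    | tmul p r =>
      rw [commutantMul_tmul, hn']
      have h1 : ∀ i, tr (y i • r • (p : o.P)) ⊗ₜ[a.invariants] x i =
          p ⊗ₜ[a.invariants] ((a.trace (y i * r) : R) * x i) := fun i => by
        rw [← mul_smul, htr', TensorProduct.smul_tmul]; rfl
      rw [Finset.sum_congr rfl fun i _ => h1 i, ← TensorProduct.tmul_sum, a.sum_mul_trace hxy]
    | add s t hs ht => rw [map_add, map_add, hs, ht]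
  · ext p
    change commutantMul o (n p) = p
    rw [hn', map_sum]
    have h1 : ∀ i, commutantMul o (tr (y i • p) ⊗ₜ[a.invariants] x i) =
        ∑ g, (x i * a.act g (y i)) • β g p := fun i => by
      rw [commutantMul_tmul, htr, Finset.smul_sum]
      exact Finset.sum_congr rfl fun g _ => by rw [hsmul, mul_smul]
    rw [Finset.sum_congr rfl fun i _ => h1 i, Finset.sum_comm,
      Finset.sum_congr rfl fun g _ => (Finset.sum_smul (M := o.P)).symm]
    simp [hxy, hone]

end UnitalPartialAction

/-! ### The isomorphism with the Picard group of the invariants -/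

namespace UnitalPartialAction

variable {G : Type v} [Group G] {R : Type u} [CommRing R] (a : UnitalPartialAction G R)

/-- The class of the object induced from an invertible `R^α`-module. -/
noncomputable def picClass (P₀ : Type u) [AddCommGroup P₀] [Module a.invariants P₀]
    [Module.Invertible a.invariants P₀] :
    relPicSubgroup (ι := (a.inclAlg : R →+* a.SkewGroupRing)) R a.theta :=
  ⟨RelPic.mk (induced a.inclAlg P₀) (induced_isPicard a.inclAlg P₀),
    ⟨_, _, rfl, induced_isCentral a.inclAlg P₀,
      fun g => induced_normalizes a.inclAlg P₀ (a.theta g)⟩⟩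

variable {a} in
theorem picClass_congr {P₀ Q₀ : Type u} [AddCommGroup P₀] [Module a.invariants P₀]
    [Module.Invertible a.invariants P₀] [AddCommGroup Q₀] [Module a.invariants Q₀]
    [Module.Invertible a.invariants Q₀] (e : P₀ ≃ₗ[a.invariants] Q₀) :
    a.picClass P₀ = a.picClass Q₀ :=
  Subtype.ext (RelPic.mk_eq_mk.2 ⟨inducedCongr a.inclAlg e⟩)

theorem picClass_tensor (P₀ Q₀ : Type u) [AddCommGroup P₀] [Module a.invariants P₀]
    [Module.Invertible a.invariants P₀] [AddCommGroup Q₀] [Module a.invariants Q₀]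
    [Module.Invertible a.invariants Q₀] :
    a.picClass (P₀ ⊗[a.invariants] Q₀) = a.picClass P₀ * a.picClass Q₀ :=
  Subtype.ext (RelPic.mk_eq_mk.2 ⟨(inducedTensor a.inclAlg P₀ Q₀).symm⟩)

/-- The homomorphism `[P₀] ↦ [P₀ ⊗ R → P₀ ⊗ S]`. -/
noncomputable def picHom : CommRing.Pic a.invariants →*
    relPicSubgroup (ι := (a.inclAlg : R →+* a.SkewGroupRing)) R a.theta :=
  MonoidHom.mk' (fun M => a.picClass M) fun M N => by
    obtain ⟨e⟩ := CommRing.Pic.mk_eq_iff.1 (CommRing.Pic.mul_eq_tensor M N).symm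
    exact (picClass_congr e.symm).trans (a.picClass_tensor M N)

theorem picHom_mk (P₀ : Type u) [AddCommGroup P₀] [Module a.invariants P₀]
    [Module.Invertible a.invariants P₀] :
    a.picHom (CommRing.Pic.mk a.invariants P₀) = a.picClass P₀ :=
  picClass_congr (CommRing.Pic.mk.linearEquiv a.invariants P₀)

variable {a} [Finite G]

theorem picHom_injective (ha : a.IsPartialGalois) : Function.Injective a.picHom := by
  have := ha.finite
  refine (injective_iff_map_eq_one _).2 fun M hM => ?_
  obtain ⟨i⟩ := RelPic.mk_eq_mk.1 (congrArg Subtype.val hM)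
  obtain ⟨e⟩ := nonempty_linearEquiv_of_iso_unit a.exists_algebraMap_eq M i
  rw [← CommRing.Pic.mk_eq_self (M := M)]
  exact CommRing.Pic.mk_eq_one_iff.2 ⟨e⟩

theorem picHom_surjective (ha : a.IsPartialGalois) : Function.Surjective a.picHom := by
  have := ha.finite
  rintro ⟨_, o, ho, rfl, hc, hn⟩
  obtain ⟨o', ⟨d⟩⟩ := ho.exists_dual
  have hb := commutantMul_bijective ha hc ho.rMap_bijective hn
  have hb' := commutantMul_bijective ha (hc.dual d) d.swap.isPicard.rMap_bijective
    fun g => BimodArrow.Normalizes.dual d (hn g)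
  have := invertible_commutant a.exists_algebraMap_eq d hc hb.2 hb'.2
  refine ⟨CommRing.Pic.mk a.invariants (commutant (ι := a.inclAlg) o), ?_⟩
  rw [picHom_mk]
  exact Subtype.ext
    (RelPic.mk_eq_mk.2 (nonempty_iso_induced_commutant hc ho.rMap_bijective hb))

end UnitalPartialAction

end RelPicard

theorem theorem2p12 {G : Type v} [Group G] [Finite G] {R : Type u} [CommRing R]
    (α : RelPicard.UnitalPartialAction G R) (hα : α.IsPartialGalois) :
    ∃ ξ : CommRing.Pic α.invariants ≃*
        RelPicard.relPicSubgroup (ι := (α.inclAlg : R →+* α.SkewGroupRing)) R α.theta,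
      ∀ (P₀ : Type u) [AddCommGroup P₀] [Module α.invariants P₀]
        [Module.Invertible α.invariants P₀],
        ∃ h : (RelPicard.induced α.inclAlg P₀).IsPicard,
          (ξ (CommRing.Pic.mk α.invariants P₀) :
              RelPicard.RelPic (α.inclAlg : R →+* α.SkewGroupRing)) =
            RelPicard.RelPic.mk (RelPicard.induced α.inclAlg P₀) h := by
  let ξ := MulEquiv.ofBijective α.picHom
    ⟨RelPicard.UnitalPartialAction.picHom_injective hα,
      RelPicard.UnitalPartialAction.picHom_surjective hα⟩
  exact ⟨ξ, fun P₀ _ _ _ => ⟨RelPicard.induced_isPicard α.inclAlg P₀,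
    congrArg Subtype.val (α.picHom_mk P₀)⟩⟩
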